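/- **Setting.** An $M$-player game ($M\ge 1$) is given by, for each player $i$, vectors $y_{i,1},\dots,y_{i,n}\in\mathbb R^d$ ($n\ge 1$), whose convex hull $S_i$ is the strategy space of player $i$, and a utility $T_i:\prod_j S_j\to\mathbb R$. For $2\le p<\infty$ it is a *$\lambda_p$-Lipschitz game with norm bound $\gamma$* if for every player $i$ we have $\|x_i\|_p\le\gamma$ for all $x_i\in S_i$ and $|T_i(\mathbf x)-T_i(\mathbf y)|\le\lambda\|\mathbf x-\mathbf y\|_p$ for all profiles $\mathbf x,\mathbf y\in\prod_j S_j$, where $\|\cdot\|_p$ of a profile is the $p$-norm of the concatenated vector in $\mathbb R^{Md}$. A profile $\mathbf x$ is an *$\epsilon$-equilibrium* if $T_i(\mathbf x)\ge T_i(x_i',\mathbf x_{-i})-\epsilon$ for every player $i$ and all $x_i'\in S_i$; an *exact equilibrium* is a $0$-equilibrium. Algorithms are programs for a unit-cost real random access machine with integer, real and $\mathbb R^d$-valued memory: each integer or real arithmetic operation, comparison, memory access, addition or scaling of vectors in $\mathbb R^d$, and evaluation of a utility $T_i$ at a profile in memory takes one step; the program has no other access to the utilities. **Theorem.** There are a single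 algorithm and absolute constants $C,c$ such that the following holds for all $M,n\ge 1$, $d\ge 0$, $2\le p<\infty$, $\lambda,\gamma\in\mathbb R$ and $\epsilon>0$. There are natural numbers $k\le c\,\frac{\lambda^2Mp\gamma^2}{\epsilon^2}$ and $l\le c\,\frac{\lambda^2p\gamma^2}{\epsilon^2}$ such that on every $M$-player $\lambda_p$-Lipschitz game with norm bound $\gamma$, given by $M,n,d,\lambda,p,\gamma$, the vectors $y_{i,j}$, and access to the utilities, together with $\epsilon$, the algorithm halts after at most $C\,M\,n^{Mk+l}$ steps and either outputs a $3\epsilon$-equilibrium, or correctly reports that the game has no exact equilibrium. In particular, if the game has an exact equilibrium, the algorithm outputs a $3\epsilon$-equilibrium. -/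

import Mathlib

namespace LipGame

/-! ## Games with continuous strategy spaces -/

/-- The `p`-norm `(∑ i, |x i| ^ p) ^ (1 / p)` of a finitely indexed real vector. -/
noncomputable def pNorm {ι : Type} [Fintype ι] (p : ℝ) (x : ι → ℝ) : ℝ :=
  (∑ i, |x i| ^ p) ^ (1 / p)

/-- A strategy profile of `M` players, each of whom plays a vector of `ℝ^d`. -/
abbrev Profile (M d : ℕ) : Type := Fin M → Fin d → ℝ

/-- The data of a game: for each of the `M` players, `n` vectors of `ℝ^d` that span the strategy
space, and a utility. Only the values of the utilities on profiles of strategies matter to the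
notions below; outside of these profiles a utility is an arbitrary function. -/
structure Game (M n d : ℕ) where
  vertex : Fin M → Fin n → Fin d → ℝ
  utility : Fin M → Profile M d → ℝ

namespace Game

variable {M n d : ℕ}

/-- The strategy space of player `i`: the convex hull of the `n` given vectors. -/
def strategySpace (G : Game M n d) (i : Fin M) : Set (Fin d → ℝ) :=
  convexHull ℝ (Set.range (G.vertex i))

/-- The strategy profiles of the game. -/
def profiles (G : Game M n d) : Set (Profile M d) :=
  {x | ∀ i, x i ∈ G.strategySpace i}

/-- `λ_p`-Lipschitz games with norm bound `γ`: strategies have `p`-norm at most `γ`, and every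
utility is `lam`-Lipschitz for the `p`-norm of profiles, regarded as vectors with `M * d`
coordinates. -/
def IsLipschitz (G : Game M n d) (lam p γ : ℝ) : Prop :=
  ∀ i : Fin M,
    (∀ x ∈ G.strategySpace i, pNorm p x ≤ γ) ∧
    ∀ x ∈ G.profiles, ∀ y ∈ G.profiles,
      |G.utility i x - G.utility i y| ≤
        lam * pNorm p (fun c : Fin M × Fin d => x c.1 c.2 - y c.1 c.2)

/-- A strategy profile at which no player gains more than `ε` by a unilateral deviation. -/
def IsApproxEquilibrium (G : Game M n d) (ε : ℝ) (x : Profile M d) : Prop :=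
  x ∈ G.profiles ∧ ∀ i : Fin M, ∀ z ∈ G.strategySpace i,
    G.utility i (Function.update x i z) - ε ≤ G.utility i x

/-- An (exact) equilibrium: no player gains by a unilateral deviation. -/
def IsEquilibrium (G : Game M n d) (x : Profile M d) : Prop :=
  x ∈ G.profiles ∧ ∀ i : Fin M, ∀ z ∈ G.strategySpace i,
    G.utility i (Function.update x i z) ≤ G.utility i x

end Game

/-! ## Programs with a step count

Programs of a unit-cost real random access machine. Its memory consists of arrays of natural
numbers, arrays of real numbers and arrays of vectors of `ℝ^d`. Array names are literals of the
program, indices are computed, and a scalar variable is cell `0` of an array. Arithmetic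
operations, comparisons, memory accesses, operations on vectors, and evaluations of a utility at a
profile held in memory take one step each. Programs contain no literals other than natural
numbers, there is no rounding operation on the reals, and the game is accessible only through the
input and the evaluation of utilities. -/

/-- The memory: `s.nat A a`, `s.real A a`, `s.vec A a` are the contents of cell `a` of array `A` of
the respective sort. -/
structure Store (d : ℕ) where
  nat : ℕ → ℕ → ℕ
  real : ℕ → ℕ → ℝ
  vec : ℕ → ℕ → Fin d → ℝ

/-- Expressions with values in the natural numbers. -/
inductive NatExpr : Type
  | const (c : ℕ)
  | read (A : ℕ) (a : NatExpr)
  | add (e f : NatExpr)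
  | sub (e f : NatExpr)
  | mul (e f : NatExpr)

/-- Expressions with real values. `utility i A` is the utility of player `i` at the profile in
which player `j` plays the vector in cell `j` of the vector array `A`. -/
inductive RealExpr : Type
  | const (c : ℕ)
  | ofNat (e : NatExpr)
  | read (A : ℕ) (a : NatExpr)
  | add (e f : RealExpr)
  | sub (e f : RealExpr)
  | mul (e f : RealExpr)
  | div (e f : RealExpr)
  | utility (i : NatExpr) (A : ℕ)

/-- Expressions with values in `ℝ^d`. -/
inductive VecExpr : Type
  | zero
  | read (A : ℕ) (a : NatExpr)
  | add (u v : VecExpr)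
  | smul (c : RealExpr) (v : VecExpr)

/-- Tests. -/
inductive Test : Type
  | natLt (e f : NatExpr)
  | realLt (e f : RealExpr)
  | neg (b : Test)
  | conj (b c : Test)

/-- Programs. -/
inductive Program : Type
  | nop
  | setNat (A : ℕ) (a : NatExpr) (e : NatExpr)
  | setReal (A : ℕ) (a : NatExpr) (e : RealExpr)
  | setVec (A : ℕ) (a : NatExpr) (v : VecExpr)
  | seq (P Q : Program)
  | branch (b : Test) (P Q : Program)
  | loop (b : Test) (P : Program)

section Semantics

variable {M n d : ℕ}

/-- The contents of `s` after writing `v` to cell `a` of the array `A` of natural numbers. -/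
def Store.setNat (s : Store d) (A a v : ℕ) : Store d :=
  { s with nat := Function.update s.nat A (Function.update (s.nat A) a v) }

/-- The contents of `s` after writing `v` to cell `a` of the array `A` of real numbers. -/
def Store.setReal (s : Store d) (A a : ℕ) (v : ℝ) : Store d :=
  { s with real := Function.update s.real A (Function.update (s.real A) a v) }

/-- The contents of `s` after writing `v` to cell `a` of the array `A` of vectors. -/
def Store.setVec (s : Store d) (A a : ℕ) (v : Fin d → ℝ) : Store d :=
  { s with vec := Function.update s.vec A (Function.update (s.vec A) a v) }

/-- The profile held in cells `0, …, M - 1` of the vector array `A`. -/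
def Store.profile (s : Store d) (M A : ℕ) : Profile M d := fun j => s.vec A j

/-- Values of expressions; the subtraction is truncated. -/
def NatExpr.eval (s : Store d) : NatExpr → ℕ
  | .const c => c
  | .read A a => s.nat A (a.eval s)
  | .add e f => e.eval s + f.eval s
  | .sub e f => e.eval s - f.eval s
  | .mul e f => e.eval s * f.eval s

/-- Values of expressions; a division by zero and the utility of a player who does not exist
have the value `0`. -/
noncomputable def RealExpr.eval (G : Game M n d) (s : Store d) : RealExpr → ℝ
  | .const c => (c : ℝ)
  | .ofNat e => ((e.eval s : ℕ) : ℝ)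
  | .read A a => s.real A (a.eval s)
  | .add e f => e.eval G s + f.eval G s
  | .sub e f => e.eval G s - f.eval G s
  | .mul e f => e.eval G s * f.eval G s
  | .div e f => e.eval G s / f.eval G s
  | .utility i A =>
      if h : i.eval s < M then G.utility ⟨i.eval s, h⟩ (s.profile M A) else 0

/-- Values of expressions. -/
noncomputable def VecExpr.eval (G : Game M n d) (s : Store d) : VecExpr → Fin d → ℝ
  | .zero => 0
  | .read A a => s.vec A (a.eval s)
  | .add u v => u.eval G s + v.eval G s
  | .smul c v => c.eval G s • v.eval G s

/-- Truth of tests. -/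
def Test.holds (G : Game M n d) (s : Store d) : Test → Prop
  | .natLt e f => e.eval s < f.eval s
  | .realLt e f => e.eval G s < f.eval G s
  | .neg b => ¬ b.holds G s
  | .conj b c => b.holds G s ∧ c.holds G s

/-- The number of steps of the evaluation of an expression: one for each of its nodes. -/
def NatExpr.cost : NatExpr → ℕ
  | .const _ => 1
  | .read _ a => a.cost + 1
  | .add e f => e.cost + f.cost + 1
  | .sub e f => e.cost + f.cost + 1
  | .mul e f => e.cost + f.cost + 1

/-- The number of steps of the evaluation of an expression: one for each of its nodes. -/
def RealExpr.cost : RealExpr → ℕ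
  | .const _ => 1
  | .ofNat e => e.cost + 1
  | .read _ a => a.cost + 1
  | .add e f => e.cost + f.cost + 1
  | .sub e f => e.cost + f.cost + 1
  | .mul e f => e.cost + f.cost + 1
  | .div e f => e.cost + f.cost + 1
  | .utility i _ => i.cost + 1

/-- The number of steps of the evaluation of an expression: one for each of its nodes. -/
def VecExpr.cost : VecExpr → ℕ
  | .zero => 1
  | .read _ a => a.cost + 1
  | .add u v => u.cost + v.cost + 1
  | .smul c v => c.cost + v.cost + 1

/-- The number of steps of the evaluation of a test: one for each of its nodes. -/
def Test.cost : Test → ℕ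
  | .natLt e f => e.cost + f.cost + 1
  | .realLt e f => e.cost + f.cost + 1
  | .neg b => b.cost + 1
  | .conj b c => b.cost + c.cost + 1

/-- `Runs G P s t s'`: on the game `G`, the program `P` started with memory `s` halts after exactly
`t` steps with memory `s'`. -/
inductive Runs (G : Game M n d) : Program → Store d → ℕ → Store d → Prop
  | nop (s : Store d) : Runs G .nop s 1 s
  | setNat (A : ℕ) (a e : NatExpr) (s : Store d) :
      Runs G (.setNat A a e) s (a.cost + e.cost + 1) (s.setNat A (a.eval s) (e.eval s))
  | setReal (A : ℕ) (a : NatExpr) (e : RealExpr) (s : Store d) :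
      Runs G (.setReal A a e) s (a.cost + e.cost + 1) (s.setReal A (a.eval s) (e.eval G s))
  | setVec (A : ℕ) (a : NatExpr) (v : VecExpr) (s : Store d) :
      Runs G (.setVec A a v) s (a.cost + v.cost + 1) (s.setVec A (a.eval s) (v.eval G s))
  | seq {P Q : Program} {s s' s'' : Store d} {t t' : ℕ} :
      Runs G P s t s' → Runs G Q s' t' s'' → Runs G (.seq P Q) s (t + t') s''
  | branchTrue {b : Test} {P Q : Program} {s s' : Store d} {t : ℕ} :
      b.holds G s → Runs G P s t s' → Runs G (.branch b P Q) s (b.cost + t + 1) s'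
  | branchFalse {b : Test} {P Q : Program} {s s' : Store d} {t : ℕ} :
      ¬ b.holds G s → Runs G Q s t s' → Runs G (.branch b P Q) s (b.cost + t + 1) s'
  | loopTrue {b : Test} {P : Program} {s s' s'' : Store d} {t t' : ℕ} :
      b.holds G s → Runs G P s t s' → Runs G (.loop b P) s' t' s'' →
      Runs G (.loop b P) s (b.cost + t + t' + 1) s''
  | loopFalse {b : Test} {P : Program} {s : Store d} :
      ¬ b.holds G s → Runs G (.loop b P) s (b.cost + 1) s

/-- A program has at most one outcome and one running time on a given input. -/
theorem Runs.deterministic {G : Game M n d} {P : Program} {s s₁ s₂ : Store d} {t₁ t₂ : ℕ}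
    (h₁ : Runs G P s t₁ s₁) (h₂ : Runs G P s t₂ s₂) : t₁ = t₂ ∧ s₁ = s₂ := by
  induction h₁ generalizing t₂ s₂ with
  | nop s => cases h₂; exact ⟨rfl, rfl⟩
  | setNat A a e s => cases h₂; exact ⟨rfl, rfl⟩
  | setReal A a e s => cases h₂; exact ⟨rfl, rfl⟩
  | setVec A a v s => cases h₂; exact ⟨rfl, rfl⟩
  | seq _ _ ih ih' =>
    cases h₂ with
    | seq k k' =>
      obtain ⟨rfl, rfl⟩ := ih k
      obtain ⟨rfl, rfl⟩ := ih' k'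
      exact ⟨rfl, rfl⟩
  | branchTrue hb _ ih =>
    cases h₂ with
    | branchTrue _ k => obtain ⟨rfl, rfl⟩ := ih k; exact ⟨rfl, rfl⟩
    | branchFalse hb' _ => exact absurd hb hb'
  | branchFalse hb _ ih =>
    cases h₂ with
    | branchTrue hb' _ => exact absurd hb' hb
    | branchFalse _ k => obtain ⟨rfl, rfl⟩ := ih k; exact ⟨rfl, rfl⟩
  | loopTrue hb _ _ ih ih' =>
    cases h₂ with
    | loopTrue _ k k' =>
      obtain ⟨rfl, rfl⟩ := ih k
      obtain ⟨rfl, rfl⟩ := ih' k'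
      exact ⟨rfl, rfl⟩
    | loopFalse hb' => exact absurd hb hb'
  | loopFalse hb =>
    cases h₂ with
    | loopTrue hb' _ _ => exact absurd hb' hb
    | loopFalse _ => exact ⟨rfl, rfl⟩

end Semantics

/-- The input: cells `0, 1, 2` of array `0` of natural numbers hold `M, n, d`, cells `0, 1, 2, 3` of
array `0` of real numbers hold `lam, p, γ, ε`, and cell `n * i + j` of array `0` of vectors holds the
`j`-th vector of player `i` (players and vectors are numbered from `0`). All other cells are `0`. -/
noncomputable def input {M n d : ℕ} (G : Game M n d) (lam p γ ε : ℝ) : Store d where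
  nat A a := if A = 0 then (if a = 0 then M else if a = 1 then n else if a = 2 then d else 0) else 0
  real A a :=
    if A = 0 then
      (if a = 0 then lam else if a = 1 then p else if a = 2 then γ else if a = 3 then ε else 0)
    else 0
  vec A a :=
    if h : A = 0 ∧ a < M * n then
      G.vertex (finProdFinEquiv.symm ⟨a, h.2⟩).1 (finProdFinEquiv.symm ⟨a, h.2⟩).2
    else 0

/-- The output convention. Cell `0` of array `1` of natural numbers is the verdict. Verdict `1`: a
profile was found, and it is held in cells `0, …, M - 1` of array `1` of vectors. -/
def Found {d : ℕ} (s : Store d) : Prop := s.nat 1 0 = 1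

/-- Verdict `0`: the program claims that the game has no equilibrium. -/
def ReportsNone {d : ℕ} (s : Store d) : Prop := s.nat 1 0 = 0

/-- The profile that is held in array `1` of vectors. -/
def outputProfile {d : ℕ} (s : Store d) (M : ℕ) : Profile M d := s.profile M 1

end LipGame

open LipGame

namespace LipGame

/-! ## Approximation of convex combinations by averages in the `p`-norm -/

section Analysis

open Finset

/-! Write X for `lam ^ 2 * M * p * γ ^ 2 / ε ^ 2`. The proof replaces the continuous strategy spaces
by finite grids of averages of k vertices and searches all grid profiles.

The analytic core, `exists_average_pNorm_sub_le`, is a derandomized approximate Carathéodory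
theorem: every point of a strategy space is within 2γ√(7p/k) of an average of k vertices. The
vertices are chosen greedily. If x is the sum of the centered vectors chosen so far, some centered
vertex h has nonpositive inner product with the gradient of the p-th power of the norm at x, because
the centered vertices have weighted mean zero (`exists_inner_nonpos`). A second-order expansion
(`sum_abs_add_rpow_le`) then shows that the squared norm bound grows only by a multiple of p per
step. Since p ≥ 2, errors η of all M players combine to at most √M η (`pNorm_profile_le`), so for k
≥ 28 X rounding a profile to the grid changes each utility by at most ε (`mul_sqrt_le`).

Call a grid profile good if no player gains more than 2ε by switching to a grid strategy. Rounding
an exact equilibrium gives a good profile: one ε is lost in the utility of the profile, one in that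
of the deviation (`resists_of_isEquilibrium`). Conversely a good profile is a 3ε-equilibrium, the
third ε paying for rounding an arbitrary deviation (`isApproxEquilibrium_of_resists`). Hence an
unsuccessful search rules out exact equilibria.

There are N = n^(Mk) grid profiles, coded by the base-n digits of a number below N. Testing all
pairs, with decoding at O(N²) steps, costs O(N⁴), which is why the exponent finally reported is 4k.
Parameter sets with n = 1 or X < 1 are treated apart: there every profile is a 3ε-equilibrium. -/

theorem rpow_tangent_le {q x y : ℝ} (hq : 1 ≤ q) (hx : 0 ≤ x) (hy : 0 ≤ y) :
    x ^ q + q * x ^ (q - 1) * (y - x) ≤ y ^ q := by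
  rcases hx.eq_or_lt with rfl | hx
  -- At x = 0 the case q = 1 is separate because `0 ^ 0 = 1`.
  · rcases hq.eq_or_lt with rfl | hq
    · simp
    · rw [Real.zero_rpow (by linarith), Real.zero_rpow (by linarith)]
      simpa using Real.rpow_nonneg hy q
  · have h := one_add_mul_self_le_rpow_one_add (s := y / x - 1)
      (by have := div_nonneg hy hx.le; linarith) hq
    have e : 1 + (y / x - 1) = y / x := by ring
    rw [e, Real.div_rpow hy hx.le, le_div_iff₀ (Real.rpow_pos_of_pos hx q)] at h
    have e2 : x ^ q = x ^ (q - 1) * x := by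
      rw [← Real.rpow_add_one hx.ne', sub_add_cancel]
    refine le_trans (le_of_eq ?_) h
    rw [e2]; field_simp

/-- The function t ↦ |t|^(p-2) t has derivative (p-1)|t|^(p-2), so it is Lipschitz on [-R, R] with
this constant at R. The argument avoids calculus by applying the tangent inequality to the exponent
p-1. -/
theorem abs_rpow_mul_sub_mul_sub_le {p u v R : ℝ} (hp : 2 ≤ p) (hu : |u| ≤ R) (hv : |v| ≤ R) :
    (|u| ^ (p - 2) * u - |v| ^ (p - 2) * v) * (u - v) ≤ (p - 1) * R ^ (p - 2) * (u - v) ^ 2 := by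
  wlog h : |v| ≤ |u| generalizing u v
  · have := this hv hu (le_of_not_ge h)
    linarith
  have hR : |u| ^ (p - 2) ≤ R ^ (p - 2) :=
    Real.rpow_le_rpow (abs_nonneg u) hu (by linarith)
  have hAB : |v| ^ (p - 2) ≤ |u| ^ (p - 2) :=
    Real.rpow_le_rpow (abs_nonneg v) h (by linarith)
  have hA := Real.rpow_nonneg (abs_nonneg u) (p - 2)
  have key := rpow_tangent_le (q := p - 1) (by linarith) (abs_nonneg u) (abs_nonneg v)
  have split : ∀ t : ℝ, |t| ^ (p - 1) = |t| ^ (p - 2) * |t| := fun t => by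
    rcases (abs_nonneg t).eq_or_lt with h0 | h0
    · rw [← h0, Real.zero_rpow (by linarith), mul_zero]
    · rw [← Real.rpow_add_one h0.ne']; ring_nf
  rw [split u, split v, show p - 1 - 1 = p - 2 by ring] at key
  generalize |u| ^ (p - 2) = A at *
  generalize |v| ^ (p - 2) = B at *
  have huv : v * u ≤ |v| * |u| := by rw [← abs_mul]; exact le_abs_self _
  have hsq : (|u| - |v|) ^ 2 ≤ (u - v) ^ 2 := by
    nlinarith [sq_abs u, sq_abs v]
  -- The splitting behind the rest is Au - Bv = A(u - v) + (A - B)v; the second term is bounded by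
  -- the tangent inequality `key`.
  have h1 : (A - B) * (v * (u - v)) ≤ (A - B) * (|v| * (|u| - |v|)) := by
    refine mul_le_mul_of_nonneg_left ?_ (by linarith)
    nlinarith [sq_abs v]
  have h2 : (A - B) * |v| * (|u| - |v|) ≤ (p - 2) * A * (|u| - |v|) * (|u| - |v|) :=
    mul_le_mul_of_nonneg_right (by linarith) (by linarith)
  have h3 : (p - 2) * A * (|u| - |v|) ^ 2 ≤ (p - 2) * A * (u - v) ^ 2 :=
    mul_le_mul_of_nonneg_left hsq (mul_nonneg (by linarith) hA)
  have h4 : (p - 1) * A * (u - v) ^ 2 ≤ (p - 1) * R ^ (p - 2) * (u - v) ^ 2 :=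
    mul_le_mul_of_nonneg_right (mul_le_mul_of_nonneg_left hR (by linarith)) (sq_nonneg _)
  nlinarith

/-- Second-order Taylor bound for |·|^p at a. The tangent is taken at a + b, which bounds |a + b|^p
from above by a term linear in b; the preceding Lipschitz estimate then moves the slope back to a.
-/
theorem abs_add_rpow_le {p : ℝ} (hp : 2 ≤ p) (a b : ℝ) :
    |a + b| ^ p ≤ |a| ^ p + p * (|a| ^ (p - 2) * a * b)
      + p ^ 2 * ((|a| + |b|) ^ (p - 2) * |b| ^ (2 : ℝ)) := by
  have h1 := rpow_tangent_le (q := p) (by linarith) (abs_nonneg (a + b)) (abs_nonneg a)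
  have h2 := abs_rpow_mul_sub_mul_sub_le hp (abs_add_le a b)
    (le_add_of_nonneg_right (abs_nonneg b) : |a| ≤ |a| + |b|)
  have h3 : |a + b| ^ (p - 1) * (|a + b| - |a|) ≤ |a + b| ^ (p - 2) * (a + b) * b := by
    have : |a + b| ^ (p - 1) = |a + b| ^ (p - 2) * |a + b| := by
      rcases (abs_nonneg (a + b)).eq_or_lt with h0 | h0
      · rw [← h0, Real.zero_rpow (by linarith), mul_zero]
      · rw [← Real.rpow_add_one h0.ne']; ring_nf
    rw [this, mul_assoc, mul_assoc]
    refine mul_le_mul_of_nonneg_left ?_ (Real.rpow_nonneg (abs_nonneg _) _)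
    have : (a + b) * a ≤ |a + b| * |a| := by rw [← abs_mul]; exact le_abs_self _
    nlinarith [sq_abs (a + b)]
  have h4 : (0 : ℝ) ≤ (|a| + |b|) ^ (p - 2) * b ^ 2 := by positivity
  rw [Real.rpow_two, sq_abs]
  have e : a + b - a = b := by ring
  rw [e] at h2
  have h5 := mul_le_mul_of_nonneg_left h3 (by linarith : 0 ≤ p)
  have h6 := mul_le_mul_of_nonneg_left h2 (by linarith : 0 ≤ p)
  have h7 : p * (p - 1) * ((|a| + |b|) ^ (p - 2) * b ^ 2)
      ≤ p ^ 2 * ((|a| + |b|) ^ (p - 2) * b ^ 2) :=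
    mul_le_mul_of_nonneg_right (by nlinarith) h4
  linarith

/-! ### The p-norm and its smoothness -/

variable {ι : Type} [Fintype ι]

theorem pNorm_nonneg (p : ℝ) (x : ι → ℝ) : 0 ≤ pNorm p x :=
  Real.rpow_nonneg (sum_nonneg fun _ _ => Real.rpow_nonneg (abs_nonneg _) _) _

theorem pNorm_rpow {p : ℝ} (hp : 0 < p) (x : ι → ℝ) : pNorm p x ^ p = ∑ i, |x i| ^ p := by
  rw [pNorm, ← Real.rpow_mul (sum_nonneg fun _ _ => Real.rpow_nonneg (abs_nonneg _) _),
    one_div_mul_cancel hp.ne', Real.rpow_one]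

theorem pNorm_le_of_sum_le {p B : ℝ} (hp : 0 < p) (hB : 0 ≤ B) {x : ι → ℝ}
    (h : ∑ i, |x i| ^ p ≤ B ^ p) : pNorm p x ≤ B := by
  rwa [← pNorm_rpow hp, Real.rpow_le_rpow_iff (pNorm_nonneg p x) hB hp] at h

theorem pNorm_add_le {p : ℝ} (hp : 1 ≤ p) (x y : ι → ℝ) :
    pNorm p (x + y) ≤ pNorm p x + pNorm p y :=
  Real.Lp_add_le univ x y hp

theorem pNorm_neg (p : ℝ) (x : ι → ℝ) : pNorm p (-x) = pNorm p x := by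
  simp [pNorm]

theorem pNorm_sub_le {p : ℝ} (hp : 1 ≤ p) (x y : ι → ℝ) :
    pNorm p (x - y) ≤ pNorm p x + pNorm p y := by
  rw [sub_eq_add_neg, ← pNorm_neg p y]
  exact pNorm_add_le hp x (-y)

theorem pNorm_abs (p : ℝ) (x : ι → ℝ) : pNorm p (fun i => |x i|) = pNorm p x := by
  simp [pNorm]

theorem pNorm_smul {p : ℝ} (hp : 0 < p) (c : ℝ) (x : ι → ℝ) :
    pNorm p (c • x) = |c| * pNorm p x := by
  simp only [pNorm, Pi.smul_apply, smul_eq_mul, abs_mul,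
    Real.mul_rpow (abs_nonneg _) (abs_nonneg _), ← mul_sum]
  rw [Real.mul_rpow (Real.rpow_nonneg (abs_nonneg _) _)
    (sum_nonneg fun _ _ => Real.rpow_nonneg (abs_nonneg _) _), ← Real.rpow_mul (abs_nonneg _),
    mul_one_div_cancel hp.ne', Real.rpow_one]

/-- Hölder with the exponents p/(p-2) and p/2; the first degenerates at p = 2, where equality holds.
-/
theorem sum_rpow_mul_rpow_two_le {p : ℝ} (hp : 2 ≤ p) (f g : ι → ℝ) :
    ∑ i, |f i| ^ (p - 2) * |g i| ^ (2 : ℝ) ≤ pNorm p f ^ (p - 2) * pNorm p g ^ (2 : ℝ) := by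
  rcases hp.eq_or_lt with rfl | hp
  · simp only [sub_self, Real.rpow_zero, one_mul]
    rw [pNorm_rpow two_pos]
  · have hp0 : 0 < p := by linarith
    have hc : (p / (p - 2)).HolderConjugate (p / 2) := by
      rw [Real.holderConjugate_iff]
      have : 0 < p - 2 := by linarith
      refine ⟨by rw [lt_div_iff₀ this]; linarith, by field_simp; ring⟩
    have h := Real.inner_le_Lp_mul_Lq univ (fun i => |f i| ^ (p - 2))
      (fun i => |g i| ^ (2 : ℝ)) hc
    refine h.trans (le_of_eq ?_)
    have hp2 : p - 2 ≠ 0 := by linarith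
    have e1 : ∀ i, |(|f i| ^ (p - 2))| ^ (p / (p - 2)) = |f i| ^ p := fun i => by
      rw [abs_of_nonneg (Real.rpow_nonneg (abs_nonneg _) _), ← Real.rpow_mul (abs_nonneg _)]
      congr 1; field_simp
    have e2 : ∀ i, |(|g i| ^ (2 : ℝ))| ^ (p / 2) = |g i| ^ p := fun i => by
      rw [abs_of_nonneg (Real.rpow_nonneg (abs_nonneg _) _), ← Real.rpow_mul (abs_nonneg _)]
      congr 1; field_simp
    simp only [e1, e2]
    have nn : ∀ x : ι → ℝ, 0 ≤ ∑ i, |x i| ^ p :=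
      fun x => sum_nonneg fun _ _ => Real.rpow_nonneg (abs_nonneg _) _
    rw [pNorm, pNorm, ← Real.rpow_mul (nn f), ← Real.rpow_mul (nn g)]
    congr 2 <;> field_simp

/-- The scalar expansion summed over coordinates: Hölder and Minkowski control the remainder by
norms alone. -/
theorem sum_abs_add_rpow_le {p B g : ℝ} (hp : 2 ≤ p) {x h : ι → ℝ}
    (hB : pNorm p x ≤ B) (hg : pNorm p h ≤ g) :
    ∑ i, |x i + h i| ^ p ≤ B ^ p + p * ∑ i, |x i| ^ (p - 2) * x i * h i
      + p ^ 2 * ((B + g) ^ (p - 2) * g ^ 2) := by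
  have h1 : ∑ i, |x i + h i| ^ p ≤ ∑ i, (|x i| ^ p + p * (|x i| ^ (p - 2) * x i * h i)
      + p ^ 2 * (|(|x i| + |h i|)| ^ (p - 2) * |h i| ^ (2 : ℝ))) := by
    refine sum_le_sum fun i _ => ?_
    rw [abs_of_nonneg (by positivity : 0 ≤ |x i| + |h i|)]
    exact abs_add_rpow_le hp _ _
  rw [sum_add_distrib, sum_add_distrib, ← mul_sum, ← mul_sum] at h1
  have h2 := sum_rpow_mul_rpow_two_le hp (fun i => |x i| + |h i|) h
  have h3 : pNorm p (fun i => |x i| + |h i|) ≤ B + g := by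
    have := pNorm_add_le (by linarith : 1 ≤ p) (fun i => |x i|) (fun i => |h i|)
    rw [pNorm_abs, pNorm_abs] at this
    exact this.trans (add_le_add hB hg)
  have h4 : pNorm p (fun i => |x i| + |h i|) ^ (p - 2) * pNorm p h ^ (2 : ℝ)
      ≤ (B + g) ^ (p - 2) * g ^ 2 := by
    rw [Real.rpow_two]
    have hh := pNorm_nonneg p h
    have hs := pNorm_nonneg p (fun i => |x i| + |h i|)
    refine mul_le_mul (Real.rpow_le_rpow hs h3 (by linarith)) (by gcongr) (by positivity) ?_
    exact Real.rpow_nonneg (hs.trans h3) _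
  have h5 : ∑ i, |x i| ^ p ≤ B ^ p := by
    rw [← pNorm_rpow (by linarith : 0 < p)]
    exact Real.rpow_le_rpow (pNorm_nonneg p x) hB (by linarith)
  have h6 := mul_le_mul_of_nonneg_left (h2.trans h4) (sq_nonneg p)
  linarith

/-- For g ≤ B/p, replacing B + g by B costs a factor at most (1 + 1/p)^p ≤ e ≤ 3. The remaining B^p
+ 3p²B^(p-2)g² is the tangent line of t^(p/2) at B² with increment 6pg², which explains the 6. -/
theorem rpow_add_step_le {p B g : ℝ} (hp : 2 ≤ p) (hg : 0 < g) (hB : p * g ≤ B) :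
    B ^ p + p ^ 2 * ((B + g) ^ (p - 2) * g ^ 2) ≤ √(B ^ 2 + 6 * p * g ^ 2) ^ p := by
  have hp0 : 0 < p := by linarith
  have hB0 : 0 < B := lt_of_lt_of_le (by positivity) hB
  have h1 : (B + g) ^ (p - 2) ≤ 3 * B ^ (p - 2) := by
    have : B + g ≤ (1 + 1 / p) * B := by
      have : g ≤ B / p := by rw [le_div_iff₀ hp0]; linarith
      rw [add_mul, one_mul, one_div_mul_eq_div]; linarith
    calc (B + g) ^ (p - 2) ≤ ((1 + 1 / p) * B) ^ (p - 2) :=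
          Real.rpow_le_rpow (by positivity) this (by linarith)
      _ = (1 + 1 / p) ^ (p - 2) * B ^ (p - 2) := Real.mul_rpow (by positivity) hB0.le
      _ ≤ 3 * B ^ (p - 2) := by
          refine mul_le_mul_of_nonneg_right ?_ (by positivity)
          calc (1 + 1 / p) ^ (p - 2) ≤ (1 + 1 / p) ^ p :=
                Real.rpow_le_rpow_of_exponent_le (by simp; positivity) (by linarith)
            _ ≤ Real.exp (1 / p) ^ p := by
                refine Real.rpow_le_rpow (by positivity) ?_ hp0.le
                linarith [Real.add_one_le_exp (1 / p)]
            _ = Real.exp 1 := by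
                rw [← Real.exp_mul, one_div_mul_cancel hp0.ne']
            _ ≤ 3 := by linarith [Real.exp_one_lt_d9]
  have h2 : √(B ^ 2 + 6 * p * g ^ 2) ^ p = (B ^ 2 + 6 * p * g ^ 2) ^ (p / 2) := by
    rw [Real.sqrt_eq_rpow, ← Real.rpow_mul (by positivity)]; ring_nf
  have h3 := rpow_tangent_le (q := p / 2) (by linarith) (sq_nonneg B)
    (by positivity : 0 ≤ B ^ 2 + 6 * p * g ^ 2)
  have e1 : (B ^ 2) ^ (p / 2) = B ^ p := by
    rw [← Real.rpow_natCast, ← Real.rpow_mul hB0.le]; congr 1; push_cast; ring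
  have e2 : (B ^ 2) ^ (p / 2 - 1) = B ^ (p - 2) := by
    rw [← Real.rpow_natCast, ← Real.rpow_mul hB0.le]; congr 1; push_cast; ring
  rw [e1, e2] at h3
  rw [h2]
  refine le_trans ?_ h3
  have h4 := mul_le_mul_of_nonneg_left h1 (by positivity : 0 ≤ p ^ 2 * g ^ 2)
  linarith

/-! ### Greedy choice of the averaged vertices -/

variable {κ : Type} [Fintype κ]

theorem exists_inner_nonpos {w : κ → ℝ} {h : κ → ι → ℝ} (hw : ∀ b, 0 ≤ w b) (hw1 : ∑ b, w b = 1)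
    (h0 : ∑ b, w b • h b = 0) (a : ι → ℝ) : ∃ b, ∑ i, a i * h b i ≤ 0 := by
  by_contra! hc
  have h1 : ∑ b, w b * ∑ i, a i * h b i = 0 := by
    have : ∑ b, w b * ∑ i, a i * h b i = ∑ i, a i * (∑ b, w b • h b) i := by
      simp only [Finset.sum_apply, Pi.smul_apply, smul_eq_mul, mul_sum]
      rw [sum_comm]
      exact sum_congr rfl fun _ _ => sum_congr rfl fun _ _ => by ring
    rw [this, h0]; simp
  rw [sum_eq_zero_iff_of_nonneg fun b _ => mul_nonneg (hw b) (hc b).le] at h1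
  have : ∀ b, w b = 0 := fun b => by
    simpa [(hc b).ne'] using h1 b (mem_univ b)
  simp [this] at hw1

/-- Each step takes a vector with nonpositive inner product with the gradient, so only the
second-order term remains and the squared bound increases by 6pg². The offset p² makes pg ≤ B hold
from the start, as the step estimate requires. -/
theorem exists_seq_sum_le {p g : ℝ} (hp : 2 ≤ p) (hg : 0 < g) {w : κ → ℝ} {h : κ → ι → ℝ}
    (hw : ∀ b, 0 ≤ w b) (hw1 : ∑ b, w b = 1) (h0 : ∑ b, w b • h b = 0)
    (hh : ∀ b, pNorm p (h b) ≤ g) (k : ℕ) :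
    ∃ s : ℕ → κ, pNorm p (∑ m ∈ range k, h (s m)) ≤ g * √(p ^ 2 + 6 * p * k) := by
  have hp0 : 0 < p := by linarith
  induction k with
  | zero =>
    -- Only serves to show that `κ` is nonempty.
    obtain ⟨b, -⟩ := exists_inner_nonpos hw hw1 h0 0
    refine ⟨fun _ => b, pNorm_le_of_sum_le hp0 (by positivity) ?_⟩
    simp only [range_zero, sum_empty, Pi.zero_apply, abs_zero]
    rw [Real.zero_rpow hp0.ne', sum_const_zero]
    positivity
  | succ k ih =>
    obtain ⟨s, hs⟩ := ih
    set x := ∑ m ∈ range k, h (s m) with hx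
    obtain ⟨b, hb⟩ := exists_inner_nonpos hw hw1 h0 (fun i => |x i| ^ (p - 2) * x i)
    refine ⟨Function.update s k b, pNorm_le_of_sum_le hp0 (by positivity) ?_⟩
    have e : ∑ m ∈ range (k + 1), h (Function.update s k b m) = x + h b := by
      rw [sum_range_succ, Function.update_self, hx]
      congr 1
      refine sum_congr rfl fun m hm => ?_
      rw [Function.update_of_ne (mem_range.1 hm).ne]
    rw [e]
    simp only [Pi.add_apply]
    have h1 := sum_abs_add_rpow_le hp hs (hh b)
    have h2 := rpow_add_step_le (B := g * √(p ^ 2 + 6 * p * k)) hp hg (by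
      rw [mul_comm]
      refine mul_le_mul_of_nonneg_left (Real.le_sqrt_of_sq_le ?_) hg.le
      have : 0 ≤ 6 * p * k := by positivity
      linarith)
    have e2 : √((g * √(p ^ 2 + 6 * p * k)) ^ 2 + 6 * p * g ^ 2)
        = g * √(p ^ 2 + 6 * p * ((k + 1 : ℕ) : ℝ)) := by
      rw [mul_pow, Real.sq_sqrt (by positivity), ← Real.sqrt_sq hg.le, ← Real.sqrt_mul (sq_nonneg _),
        Real.sqrt_sq hg.le]
      push_cast; ring_nf
    rw [e2] at h2
    have h3 := mul_nonpos_of_nonneg_of_nonpos hp0.le hb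
    linarith

theorem exists_average_pNorm_sub_le {n d : ℕ} {p γ : ℝ} (hp : 2 ≤ p) (hγ : 0 < γ)
    {y : Fin n → Fin d → ℝ} (hy : ∀ x ∈ convexHull ℝ (Set.range y), pNorm p x ≤ γ)
    {x : Fin d → ℝ} (hx : x ∈ convexHull ℝ (Set.range y)) {k : ℕ} (hk : 1 ≤ k) :
    ∃ s : ℕ → Fin n,
      pNorm p (x - ∑ j ∈ range k, (1 / (k : ℝ)) • y (s j)) ≤ 2 * γ * √(7 * p / k) := by
  have hp0 : 0 < p := by linarith
  have hk0 : (0 : ℝ) < k := by exact_mod_cast hk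
  have hsub : ∀ b, pNorm p (y b - x) ≤ 2 * γ := fun b => by
    have := pNorm_sub_le (by linarith : 1 ≤ p) (y b) x
    linarith [hy _ hx, hy _ (subset_convexHull ℝ _ ⟨b, rfl⟩)]
  obtain ⟨κ, _, w, z, hw, hw1, hz, hwz⟩ := mem_convexHull_iff_exists_fintype.1 hx
  choose b hb using hz
  have h0 : ∑ a, w a • (y (b a) - x) = 0 := by
    simp only [hb, smul_sub, sum_sub_distrib, ← sum_smul, hw1, one_smul, hwz, sub_self]
  obtain ⟨s', hs⟩ :=
    exists_seq_sum_le hp (by positivity : 0 < 2 * γ) hw hw1 h0 (fun a => hsub (b a)) k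
  set s : ℕ → Fin n := fun j => b (s' j)
  replace hs : pNorm p (∑ j ∈ range k, (y (s j) - x)) ≤ _ := hs
  refine ⟨s, ?_⟩
  have e : x - ∑ j ∈ range k, (1 / (k : ℝ)) • y (s j)
      = (-(1 / (k : ℝ))) • ∑ j ∈ range k, (y (s j) - x) := by
    rw [sum_sub_distrib, sum_const, card_range, smul_sub, ← smul_sum, ← Nat.cast_smul_eq_nsmul ℝ,
      smul_smul, neg_mul, one_div_mul_cancel hk0.ne', neg_smul, neg_smul, one_smul]
    abel
  rw [e, pNorm_smul hp0, abs_neg, abs_of_pos (by positivity : 0 < 1 / (k : ℝ))]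
  -- For p ≤ k the offset p² is absorbed, p² + 6pk ≤ 7pk. For k ≤ p the claimed bound is at least 2γ
  -- and the triangle inequality suffices.
  rcases le_total p k with hpk | hpk
  · have : √(p ^ 2 + 6 * p * k) ≤ k * √(7 * p / k) := by
      rw [← Real.sqrt_sq hk0.le, ← Real.sqrt_mul (sq_nonneg _), Real.sqrt_sq hk0.le]
      refine Real.sqrt_le_sqrt ?_
      field_simp
      nlinarith
    calc 1 / (k : ℝ) * pNorm p (∑ j ∈ range k, (y (s j) - x))
        ≤ 1 / (k : ℝ) * (2 * γ * (k * √(7 * p / k))) := by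
          refine mul_le_mul_of_nonneg_left (hs.trans ?_) (by positivity)
          exact mul_le_mul_of_nonneg_left this (by positivity)
      _ = 2 * γ * √(7 * p / k) := by field_simp
  · have h1 : 1 ≤ √(7 * p / k) := by
      rw [Real.one_le_sqrt, le_div_iff₀ hk0]; linarith
    have h2 : ∀ m : ℕ, pNorm p (∑ j ∈ range m, (y (s j) - x)) ≤ m * (2 * γ) := fun m => by
      induction m with
      | zero =>
        refine pNorm_le_of_sum_le hp0 (by simp) ?_
        simp [Real.zero_rpow hp0.ne']
      | succ m ih =>
        rw [sum_range_succ]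
        have := pNorm_add_le (by linarith : 1 ≤ p) (∑ j ∈ range m, (y (s j) - x)) (y (s m) - x)
        have := hsub (s m)
        push_cast
        linarith
    calc 1 / (k : ℝ) * pNorm p (∑ j ∈ range k, (y (s j) - x))
        ≤ 1 / (k : ℝ) * (k * (2 * γ)) := mul_le_mul_of_nonneg_left (h2 k) (by positivity)
      _ = 2 * γ * 1 := by field_simp
      _ ≤ 2 * γ * √(7 * p / k) := mul_le_mul_of_nonneg_left h1 (by positivity)

/-- The M blocks contribute a factor M^(1/p), which is at most √M because p ≥ 2. -/
theorem pNorm_profile_le {M d : ℕ} {p η : ℝ} (hp : 2 ≤ p) (hM : 1 ≤ M) (hη : 0 ≤ η)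
    {x y : Profile M d} (h : ∀ i, pNorm p (x i - y i) ≤ η) :
    pNorm p (fun c : Fin M × Fin d => x c.1 c.2 - y c.1 c.2) ≤ √M * η := by
  have hp0 : 0 < p := by linarith
  have hM' : (1 : ℝ) ≤ M := by exact_mod_cast hM
  refine pNorm_le_of_sum_le hp0 (by positivity) ?_
  rw [Fintype.sum_prod_type]
  calc ∑ i, ∑ j, |x i j - y i j| ^ p = ∑ i, pNorm p (x i - y i) ^ p := by
        refine sum_congr rfl fun i _ => ?_
        rw [pNorm_rpow hp0]; rfl
    _ ≤ ∑ _i : Fin M, η ^ p :=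
        sum_le_sum fun i _ => Real.rpow_le_rpow (pNorm_nonneg _ _) (h i) hp0.le
    _ = M * η ^ p := by simp
    _ ≤ √M ^ p * η ^ p := by
        refine mul_le_mul_of_nonneg_right ?_ (by positivity)
        rw [Real.sqrt_eq_rpow, ← Real.rpow_mul (by linarith)]
        calc (M : ℝ) = (M : ℝ) ^ (1 : ℝ) := (Real.rpow_one _).symm
          _ ≤ (M : ℝ) ^ (1 / 2 * p) := Real.rpow_le_rpow_of_exponent_le hM' (by linarith)
    _ = (√M * η) ^ p := (Real.mul_rpow (by positivity) hη).symm

end Analysis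

/-! ## Reasoning about programs -/

section Logic

variable {M n d : ℕ} {G : Game M n d}

/-- The program `P` started with memory `s` halts after at most `T` steps, with a memory that
satisfies `Q`. -/
def Halts (G : Game M n d) (P : Program) (s : Store d) (T : ℕ) (Q : Store d → Prop) : Prop :=
  ∃ t s', Runs G P s t s' ∧ t ≤ T ∧ Q s'

theorem Halts.mono {P : Program} {s : Store d} {T T' : ℕ} {Q Q' : Store d → Prop}
    (h : Halts G P s T Q) (hT : T ≤ T') (hQ : ∀ s', Q s' → Q' s') : Halts G P s T' Q' := by
  obtain ⟨t, s', h, ht, hs⟩ := h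
  exact ⟨t, s', h, ht.trans hT, hQ _ hs⟩

theorem Halts.nop {s : Store d} {Q : Store d → Prop} (h : Q s) : Halts G .nop s 1 Q :=
  ⟨_, _, .nop s, le_rfl, h⟩

theorem Halts.setNat {A : ℕ} {a e : NatExpr} {s : Store d} {Q : Store d → Prop}
    (h : Q (s.setNat A (a.eval s) (e.eval s))) :
    Halts G (.setNat A a e) s (a.cost + e.cost + 1) Q :=
  ⟨_, _, .setNat A a e s, le_rfl, h⟩

theorem Halts.setReal {A : ℕ} {a : NatExpr} {e : RealExpr} {s : Store d} {Q : Store d → Prop}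
    (h : Q (s.setReal A (a.eval s) (e.eval G s))) :
    Halts G (.setReal A a e) s (a.cost + e.cost + 1) Q :=
  ⟨_, _, .setReal A a e s, le_rfl, h⟩

theorem Halts.setVec {A : ℕ} {a : NatExpr} {v : VecExpr} {s : Store d} {Q : Store d → Prop}
    (h : Q (s.setVec A (a.eval s) (v.eval G s))) :
    Halts G (.setVec A a v) s (a.cost + v.cost + 1) Q :=
  ⟨_, _, .setVec A a v s, le_rfl, h⟩

theorem Halts.setNat_seq {A : ℕ} {a e : NatExpr} {P : Program} {s : Store d} {T : ℕ}
    {Q : Store d → Prop} (h : Halts G P (s.setNat A (a.eval s) (e.eval s)) T Q) :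
    Halts G (.seq (.setNat A a e) P) s (a.cost + e.cost + 1 + T) Q := by
  obtain ⟨t, s', h, ht, hs⟩ := h
  exact ⟨_, _, .seq (.setNat A a e s) h, by lia, hs⟩

theorem Halts.setReal_seq {A : ℕ} {a : NatExpr} {e : RealExpr} {P : Program} {s : Store d} {T : ℕ}
    {Q : Store d → Prop} (h : Halts G P (s.setReal A (a.eval s) (e.eval G s)) T Q) :
    Halts G (.seq (.setReal A a e) P) s (a.cost + e.cost + 1 + T) Q := by
  obtain ⟨t, s', h, ht, hs⟩ := h
  exact ⟨_, _, .seq (.setReal A a e s) h, by lia, hs⟩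

theorem Halts.setVec_seq {A : ℕ} {a : NatExpr} {v : VecExpr} {P : Program} {s : Store d} {T : ℕ}
    {Q : Store d → Prop} (h : Halts G P (s.setVec A (a.eval s) (v.eval G s)) T Q) :
    Halts G (.seq (.setVec A a v) P) s (a.cost + v.cost + 1 + T) Q := by
  obtain ⟨t, s', h, ht, hs⟩ := h
  exact ⟨_, _, .seq (.setVec A a v s) h, by lia, hs⟩

theorem Halts.branch {b : Test} {P P' : Program} {s : Store d} {T : ℕ} {Q : Store d → Prop}
    (h : b.holds G s → Halts G P s T Q) (h' : ¬ b.holds G s → Halts G P' s T Q) :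
    Halts G (.branch b P P') s (b.cost + T + 1) Q := by
  by_cases hb : b.holds G s
  · obtain ⟨t, s', h, ht, hs⟩ := h hb
    exact ⟨_, _, .branchTrue hb h, by lia, hs⟩
  · obtain ⟨t, s', h, ht, hs⟩ := h' hb
    exact ⟨_, _, .branchFalse hb h, by lia, hs⟩

/-- The arrays of natural numbers that are written by a program. -/
def Program.natWrites : Program → List ℕ
  | .nop => []
  | .setNat A _ _ => [A]
  | .setReal _ _ _ => []
  | .setVec _ _ _ => []
  | .seq P Q => P.natWrites ++ Q.natWrites
  | .branch _ P Q => P.natWrites ++ Q.natWrites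
  | .loop _ P => P.natWrites

/-- The arrays of real numbers that are written by a program. -/
def Program.realWrites : Program → List ℕ
  | .nop => []
  | .setNat _ _ _ => []
  | .setReal A _ _ => [A]
  | .setVec _ _ _ => []
  | .seq P Q => P.realWrites ++ Q.realWrites
  | .branch _ P Q => P.realWrites ++ Q.realWrites
  | .loop _ P => P.realWrites

/-- The arrays of vectors that are written by a program. -/
def Program.vecWrites : Program → List ℕ
  | .nop => []
  | .setNat _ _ _ => []
  | .setReal _ _ _ => []
  | .setVec A _ _ => [A]
  | .seq P Q => P.vecWrites ++ Q.vecWrites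
  | .branch _ P Q => P.vecWrites ++ Q.vecWrites
  | .loop _ P => P.vecWrites

/-- The memories `s` and `s'` differ only in arrays that are written by `P`. -/
structure Program.Frame (P : Program) (s s' : Store d) : Prop where
  nat : ∀ A, A ∉ P.natWrites → s'.nat A = s.nat A
  real : ∀ A, A ∉ P.realWrites → s'.real A = s.real A
  vec : ∀ A, A ∉ P.vecWrites → s'.vec A = s.vec A

/-- Array names are literals, so what a run can change is visible in the program text. Loop
invariants therefore mention only the quantities that vary; everything else follows from the frame.
-/
theorem Runs.frame {P : Program} {s s' : Store d} {t : ℕ} (h : Runs G P s t s') :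
    P.Frame s s' := by
  induction h with
  | nop s => exact ⟨fun _ _ => rfl, fun _ _ => rfl, fun _ _ => rfl⟩
  | setNat A a e s =>
    refine ⟨fun B hB => ?_, fun _ _ => rfl, fun _ _ => rfl⟩
    exact Function.update_of_ne (by simpa [Program.natWrites] using hB) _ _
  | setReal A a e s =>
    refine ⟨fun _ _ => rfl, fun B hB => ?_, fun _ _ => rfl⟩
    exact Function.update_of_ne (by simpa [Program.realWrites] using hB) _ _
  | setVec A a e s =>
    refine ⟨fun _ _ => rfl, fun _ _ => rfl, fun B hB => ?_⟩
    exact Function.update_of_ne (by simpa [Program.vecWrites] using hB) _ _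
  | seq _ _ ih ih' =>
    refine ⟨fun B hB => ?_, fun B hB => ?_, fun B hB => ?_⟩
    · simp only [Program.natWrites, List.mem_append, not_or] at hB
      rw [ih'.nat B hB.2, ih.nat B hB.1]
    · simp only [Program.realWrites, List.mem_append, not_or] at hB
      rw [ih'.real B hB.2, ih.real B hB.1]
    · simp only [Program.vecWrites, List.mem_append, not_or] at hB
      rw [ih'.vec B hB.2, ih.vec B hB.1]
  | branchTrue _ _ ih =>
    refine ⟨fun B hB => ?_, fun B hB => ?_, fun B hB => ?_⟩
    · exact ih.nat B fun h => hB (List.mem_append_left _ h)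
    · exact ih.real B fun h => hB (List.mem_append_left _ h)
    · exact ih.vec B fun h => hB (List.mem_append_left _ h)
  | branchFalse _ _ ih =>
    refine ⟨fun B hB => ?_, fun B hB => ?_, fun B hB => ?_⟩
    · exact ih.nat B fun h => hB (List.mem_append_right _ h)
    · exact ih.real B fun h => hB (List.mem_append_right _ h)
    · exact ih.vec B fun h => hB (List.mem_append_right _ h)
  | loopTrue _ _ _ ih ih' =>
    exact ⟨fun B hB => (ih'.nat B hB).trans (ih.nat B hB),
      fun B hB => (ih'.real B hB).trans (ih.real B hB),
      fun B hB => (ih'.vec B hB).trans (ih.vec B hB)⟩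
  | loopFalse _ => exact ⟨fun _ _ => rfl, fun _ _ => rfl, fun _ _ => rfl⟩

theorem Program.Frame.trans {P : Program} {s s' s'' : Store d} (h : P.Frame s s')
    (h' : P.Frame s' s'') : P.Frame s s'' :=
  ⟨fun A hA => (h'.nat A hA).trans (h.nat A hA), fun A hA => (h'.real A hA).trans (h.real A hA),
    fun A hA => (h'.vec A hA).trans (h.vec A hA)⟩

theorem Halts.seq {P P' : Program} {s : Store d} {T T' : ℕ} {R Q : Store d → Prop}
    (h : Halts G P s T R) (h' : ∀ s', R s' → P.Frame s s' → Halts G P' s' T' Q) :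
    Halts G (.seq P P') s (T + T') Q := by
  obtain ⟨t, s', h, ht, hs⟩ := h
  obtain ⟨t', s'', h', ht', hs'⟩ := h' s' hs h.frame
  exact ⟨_, _, .seq h h', add_le_add ht ht', hs'⟩

/-- A loop with an invariant `I` that is executed `N` times. -/
theorem Halts.loop {b : Test} {P : Program} {s : Store d} {T : ℕ} (N : ℕ) (I : ℕ → Store d → Prop)
    (h0 : I 0 s) (hb : ∀ m s', m ≤ N → I m s' → P.Frame s s' → (b.holds G s' ↔ m < N))
    (hP : ∀ m s', m < N → I m s' → P.Frame s s' → Halts G P s' T (I (m + 1))) :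
    Halts G (.loop b P) s (N * (b.cost + T + 1) + (b.cost + 1)) (I N) := by
  suffices H : ∀ r m s', m + r = N → I m s' → P.Frame s s' →
      Halts G (.loop b P) s' (r * (b.cost + T + 1) + (b.cost + 1)) (I N) from
    H N 0 s (zero_add N) h0 ⟨fun _ _ => rfl, fun _ _ => rfl, fun _ _ => rfl⟩
  intro r
  induction r with
  | zero =>
    rintro m s' rfl hI hF
    exact ⟨_, _, .loopFalse (by simp [hb m s' le_rfl hI hF]), by simp, hI⟩
  | succ r ih =>
    rintro m s' hm hI hF
    obtain ⟨t, s₁, h, ht, hs⟩ := hP m s' (by lia) hI hF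
    obtain ⟨t', s₂, h', ht', hs'⟩ := ih (m + 1) s₁ (by lia) hs (hF.trans h.frame)
    refine ⟨_, _, .loopTrue ((hb m s' (by lia) hI hF).2 (by lia)) h h', ?_, hs'⟩
    rw [Nat.succ_mul]
    lia

/-! ### Reading memory after a write -/

@[simp]
theorem Store.nat_setNat (s : Store d) (A a v B b : ℕ) :
    (s.setNat A a v).nat B b = if B = A ∧ b = a then v else s.nat B b := by
  simp only [Store.setNat, Function.update_apply]
  split_ifs <;> simp_all

@[simp]
theorem Store.nat_setReal (s : Store d) (A a : ℕ) (v : ℝ) : (s.setReal A a v).nat = s.nat := rfl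

@[simp]
theorem Store.nat_setVec (s : Store d) (A a : ℕ) (v : Fin d → ℝ) :
    (s.setVec A a v).nat = s.nat := rfl

@[simp]
theorem Store.real_setNat (s : Store d) (A a v : ℕ) : (s.setNat A a v).real = s.real := rfl

@[simp]
theorem Store.real_setReal (s : Store d) (A a : ℕ) (v : ℝ) (B b : ℕ) :
    (s.setReal A a v).real B b = if B = A ∧ b = a then v else s.real B b := by
  simp only [Store.setReal, Function.update_apply]
  split_ifs <;> simp_all

@[simp]
theorem Store.real_setVec (s : Store d) (A a : ℕ) (v : Fin d → ℝ) :
    (s.setVec A a v).real = s.real := rfl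

@[simp]
theorem Store.vec_setNat (s : Store d) (A a v : ℕ) : (s.setNat A a v).vec = s.vec := rfl

@[simp]
theorem Store.vec_setReal (s : Store d) (A a : ℕ) (v : ℝ) : (s.setReal A a v).vec = s.vec := rfl

@[simp]
theorem Store.vec_setVec (s : Store d) (A a : ℕ) (v : Fin d → ℝ) (B b : ℕ) :
    (s.setVec A a v).vec B b = if B = A ∧ b = a then v else s.vec B b := by
  simp only [Store.setVec, Function.update_apply]
  split_ifs <;> simp_all

end Logic

/-! ## The program -/

section Algorithm

open Finset

/-- The scalar variable `A` of natural numbers. -/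
abbrev var (A : ℕ) : NatExpr := .read A (.const 0)

/-- The number of players. -/
abbrev numPlayers : NatExpr := .read 0 (.const 0)

/-- The number of vectors of each player. -/
abbrev numVertices : NatExpr := .read 0 (.const 1)

/-- Adds `1` to a scalar variable. -/
abbrev increment (A : ℕ) : Program := .setNat A (.const 0) (.add (var A) (.const 1))

/-- Sets variable `10` to the quotient of variable `7` by the number of vectors. -/
def quotient : Program :=
  .seq (.setNat 10 (.const 0) (.const 0))
    (.loop (.neg (.natLt (var 7) (.mul (.add (var 10) (.const 1)) numVertices))) (increment 10))

/-- Removes the last digit of variable `7` in base `n`, and adds `1 / k` times the vector with that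
number to the strategy of player `i` in array `A`, where `k`, `i` are variables `2`, `8`. -/
def decodeDigit (A : ℕ) : Program :=
  .seq quotient
  (.seq (.setVec A (var 8) (.add (.read A (var 8)) (.smul (.div (.const 1) (.ofNat (var 2)))
      (.read 0 (.add (.mul numVertices (var 8)) (.sub (var 7) (.mul (var 10) numVertices)))))))
  (.seq (.setNat 7 (.const 0) (var 10)) (increment 9)))

/-- Sets the strategy of player `i` in array `A` to the average of the vectors numbered by the last
`k` digits of variable `7`. -/
def decodeStrategy (A : ℕ) : Program :=
  .seq (.setVec A (var 8) .zero)
  (.seq (.setNat 9 (.const 0) (.const 0))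
  (.seq (.loop (.natLt (var 9) (var 2)) (decodeDigit A)) (increment 8)))

/-- Writes the profile that is encoded by variable `B` to array `A`. -/
def decode (A B : ℕ) : Program :=
  .seq (.setNat 7 (.const 0) (var B))
  (.seq (.setNat 8 (.const 0) (.const 0))
  (.loop (.natLt (var 8) numPlayers) (decodeStrategy A)))

/-- Clears variable `6` if player `i`, the value of variable `11`, gains more than `2 * ε` by a
deviation from array `4` to array `2`. -/
def testDeviation : Program :=
  .seq (.setReal 1 (.const 0) (.add (.utility (var 11) 4) (.mul (.const 2) (.read 0 (.const 3)))))
  (.seq (.setVec 3 (.const 0) (.read 4 (var 11)))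
  (.seq (.setVec 4 (var 11) (.read 2 (var 11)))
  (.seq (.branch (.realLt (.read 1 (.const 0)) (.utility (var 11) 4))
    (.setNat 6 (.const 0) (.const 0)) .nop)
  (.seq (.setVec 4 (var 11) (.read 3 (.const 0))) (increment 11)))))

/-- Clears variable `6` if some player gains more than `2 * ε` by a deviation from array `4` to the
profile that is encoded by variable `5`. -/
def testDeviations : Program :=
  .seq (decode 2 5)
  (.seq (.setNat 11 (.const 0) (.const 0))
  (.seq (.loop (.natLt (var 11) numPlayers) testDeviation) (increment 5)))

/-- Tests whether no player gains more than `2 * ε` by a deviation from the profile that is encoded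
by variable `4` to some encoded profile, and outputs the profile in this case. -/
def examine : Program :=
  .seq (decode 4 4)
  (.seq (.setNat 6 (.const 0) (.const 1))
  (.seq (.setNat 5 (.const 0) (.const 0))
  (.seq (.loop (.natLt (var 5) (var 3)) testDeviations)
  (.seq (.branch (.natLt (.const 0) (var 6))
    (.seq (decode 1 4) (.setNat 1 (.const 0) (.const 1))) .nop)
  (increment 4)))))

/-- Examines all encoded profiles. -/
def search : Program :=
  .seq (.setNat 4 (.const 0) (.const 0)) (.loop (.natLt (var 4) (var 3)) examine)

/-- The value `lam ^ 2 * M * p * γ ^ 2 / ε ^ 2`. -/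
def ratioExpr : RealExpr :=
  .div (.mul (.mul (.mul (.mul (.mul (.read 0 (.const 0)) (.read 0 (.const 0)))
    (.ofNat numPlayers)) (.read 0 (.const 1))) (.read 0 (.const 2))) (.read 0 (.const 2)))
    (.mul (.read 0 (.const 3)) (.read 0 (.const 3)))

/-- Sets variable `2` to the number `k` of vectors in an average. -/
def computeSize : Program :=
  .seq (.setNat 2 (.const 0) (.const 0))
    (.loop (.realLt (.ofNat (var 2)) (.mul (.const 28) ratioExpr)) (increment 2))

/-- Sets variable `3` to `n ^ (M * k)`. -/
def computeCount : Program :=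
  .seq (.setNat 3 (.const 0) (.const 1))
  (.seq (.setNat 12 (.const 0) (.const 0))
  (.loop (.natLt (var 12) (.mul numPlayers (var 2)))
    (.seq (.setNat 3 (.const 0) (.mul (var 3) numVertices)) (increment 12))))

/-- Outputs the first vector of each player. -/
def outputFirst : Program :=
  .seq (.setNat 12 (.const 0) (.const 0))
  (.seq (.loop (.natLt (var 12) numPlayers)
    (.seq (.setVec 1 (var 12) (.read 0 (.mul numVertices (var 12)))) (increment 12)))
  (.setNat 1 (.const 0) (.const 1)))

/-- Searches the profiles of averages for an approximate equilibrium. -/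
def equilibriumProgram : Program :=
  .branch (.conj (.natLt (.const 1) numVertices) (.neg (.realLt ratioExpr (.const 1))))
    (.seq computeSize (.seq computeCount search)) outputFirst

/-! ### Correctness and step counts of the subroutines -/

theorem natWrites_decodeDigit (A : ℕ) : (decodeDigit A).natWrites = [10, 10, 7, 9] := rfl

theorem natWrites_decodeStrategy (A : ℕ) :
    (decodeStrategy A).natWrites = [9, 10, 10, 7, 9, 8] := rfl

theorem vecWrites_decodeDigit (A : ℕ) : (decodeDigit A).vecWrites = [A] := rfl

theorem vecWrites_decodeStrategy (A : ℕ) : (decodeStrategy A).vecWrites = [A, A] := rfl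

variable {M n d : ℕ} {G : Game M n d}

/-- The guard says (q + 1)n ≤ x, that is, q < x / n. Counting up makes division linear in the
dividend, which is affordable since all codes are below `N`; for n = 0 the loop would not end. -/
theorem halts_quotient (s : Store d) (hn : 0 < s.nat 0 1) {N : ℕ} (hN : s.nat 7 0 < N) :
    Halts G quotient s (40 * N) fun s' => s'.nat 10 0 = s.nat 7 0 / s.nat 0 1 := by
  have hq : s.nat 7 0 / s.nat 0 1 < N := (Nat.div_le_self _ _).trans_lt hN
  refine (Halts.setNat_seq (Halts.loop (T := 7) (s.nat 7 0 / s.nat 0 1)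
    (fun m s' => s'.nat 10 0 = m) ?_ ?_ ?_)).mono ?_ fun _ h => h
  · simp [NatExpr.eval]
  · intro m s' _ hI hF
    have h0 := congrFun (hF.nat 0 (by decide)) 1
    have h7 := congrFun (hF.nat 7 (by decide)) 0
    simp [NatExpr.eval] at h0 h7
    rw [Nat.lt_iff_add_one_le, Nat.le_div_iff_mul_le hn]
    simp [Test.holds, NatExpr.eval, hI, h0, h7]
  · intro m s' _ hI _
    exact (Halts.setNat (by simp [NatExpr.eval, hI])).mono (by simp [NatExpr.cost]) fun _ h => h
  · simp only [NatExpr.cost, Test.cost]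
    lia

theorem halts_decodeDigit {A : ℕ} (s : Store d) (hn : 0 < s.nat 0 1) {N : ℕ}
    (hN : s.nat 7 0 < N) :
    Halts G (decodeDigit A) s (80 * N) fun s' =>
      s'.nat 7 0 = s.nat 7 0 / s.nat 0 1 ∧ s'.nat 9 0 = s.nat 9 0 + 1 ∧
      s'.vec A = Function.update (s.vec A) (s.nat 8 0) (s.vec A (s.nat 8 0) +
        (1 / (s.nat 2 0 : ℝ)) • s.vec 0 (s.nat 0 1 * s.nat 8 0 + s.nat 7 0 % s.nat 0 1)) := by
  refine (Halts.seq (T' := 40) (halts_quotient s hn hN) fun s' hs' hF => ?_).mono (by lia)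
    fun _ h => h
  have hv : s'.vec = s.vec := funext fun B => hF.vec B (by simp [quotient, Program.vecWrites])
  have h0 := hF.nat 0 (by decide)
  have h2 := hF.nat 2 (by decide)
  have h7 := hF.nat 7 (by decide)
  have h8 := hF.nat 8 (by decide)
  have h9 := hF.nat 9 (by decide)
  refine (Halts.setVec_seq (Halts.setNat_seq (Halts.setNat ?_))).mono
    (by simp [NatExpr.cost, VecExpr.cost, RealExpr.cost]) fun _ h => h
  refine ⟨?_, ?_, ?_⟩
  · simp [NatExpr.eval, hs']
  · simp [NatExpr.eval, h9]
  · have hm : s.nat 7 0 - s.nat 7 0 / s.nat 0 1 * s.nat 0 1 = s.nat 7 0 % s.nat 0 1 := by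
      have := Nat.mod_add_div' (s.nat 7 0) (s.nat 0 1)
      lia
    funext a
    simp [NatExpr.eval, VecExpr.eval, RealExpr.eval, Function.update_apply, hs', h0, h2, h7, h8, hv,
      hm]

/-- The average of `k` of the vectors that are held by the array `Y` for player `i`; the vectors are
numbered by the digits of `q` in base `n`. -/
noncomputable def digitAverage (Y : ℕ → Fin d → ℝ) (n k q i : ℕ) : Fin d → ℝ :=
  ∑ j ∈ range k, (1 / (k : ℝ)) • Y (n * i + q / n ^ j % n)

/-- After m digits, variable 7 holds q / n^m. The condition `A ≠ 0` protects the input vectors from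
being overwritten. -/
theorem halts_decodeStrategy {A : ℕ} (hA : A ≠ 0) (s : Store d) (hn : 0 < s.nat 0 1) {N : ℕ}
    (hN : s.nat 7 0 < N) (hk : 1 ≤ s.nat 2 0) :
    Halts G (decodeStrategy A) s (110 * s.nat 2 0 * N) fun s' =>
      s'.nat 7 0 = s.nat 7 0 / s.nat 0 1 ^ s.nat 2 0 ∧ s'.nat 8 0 = s.nat 8 0 + 1 ∧
      s'.vec A = Function.update (s.vec A) (s.nat 8 0)
        (digitAverage (s.vec 0) (s.nat 0 1) (s.nat 2 0) (s.nat 7 0) (s.nat 8 0)) := by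
  refine (Halts.setVec_seq (Halts.setNat_seq (Halts.seq (T' := 7)
    (Halts.loop (T := 80 * N) (s.nat 2 0)
      (fun m s' => s'.nat 7 0 = s.nat 7 0 / s.nat 0 1 ^ m ∧ s'.nat 9 0 = m ∧
        s'.vec A = Function.update (s.vec A) (s.nat 8 0) (∑ j ∈ range m, (1 / (s.nat 2 0 : ℝ)) •
          s.vec 0 (s.nat 0 1 * s.nat 8 0 + s.nat 7 0 / s.nat 0 1 ^ j % s.nat 0 1)))
      ?_ ?_ ?_) ?_))).mono ?_ fun _ h => h
  · refine ⟨by simp [NatExpr.eval], by simp [NatExpr.eval], ?_⟩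
    funext a
    simp [NatExpr.eval, VecExpr.eval, Function.update_apply]
  · rintro m s' - ⟨-, h9, -⟩ hF
    have h2 := congrFun (hF.nat 2 (by simp [natWrites_decodeDigit])) 0
    simp [NatExpr.eval] at h2
    simp [Test.holds, NatExpr.eval, h9, h2]
  · rintro m s' - ⟨h7, h9, hv⟩ hF
    have h2 := congrFun (hF.nat 2 (by simp [natWrites_decodeDigit])) 0
    have h0 := congrFun (hF.nat 0 (by simp [natWrites_decodeDigit])) 1
    have h8 := congrFun (hF.nat 8 (by simp [natWrites_decodeDigit])) 0
    have hv0 := fun a => congrFun (hF.vec 0 (by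
      simp [vecWrites_decodeDigit, hA.symm])) a
    simp [NatExpr.eval, hA.symm] at h2 h0 h8 hv0
    refine (halts_decodeDigit s' (h0 ▸ hn) (N := N) ?_).mono le_rfl ?_
    · rw [h7]
      exact (Nat.div_le_self _ _).trans_lt hN
    · rintro s'' ⟨h7', h9', hv'⟩
      refine ⟨?_, by rw [h9', h9], ?_⟩
      · rw [h7', h7, h0, Nat.div_div_eq_div_mul, pow_succ]
      · rw [hv', hv, h0, h2, h7, h8, sum_range_succ, hv0]
        simp
  · rintro s' ⟨h7, -, hv⟩ hF
    have h8 := congrFun (hF.nat 8 (by simp [Program.natWrites, natWrites_decodeDigit])) 0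
    simp [NatExpr.eval] at h8
    refine (Halts.setNat ?_).mono (by simp [NatExpr.cost]) fun _ h => h
    exact ⟨by simp [h7], by simp [NatExpr.eval, h8], hv⟩
  · simp only [NatExpr.cost, VecExpr.cost, Test.cost]
    have hN1 : 1 ≤ N := by lia
    nlinarith [Nat.mul_le_mul hk hN1]

/-- The strategy of player `i` in the profile that is encoded by `e`. -/
noncomputable def codedStrategy (Y : ℕ → Fin d → ℝ) (n k e i : ℕ) : Fin d → ℝ :=
  digitAverage Y n k (e / n ^ (i * k)) i

/-- The players consume successive blocks of k digits, so player i starts from the code divided by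
n^(ik). The M rounds of 110 k N steps fit the budget because Mk ≤ N. -/
theorem halts_decode {A B : ℕ} (hA : A ≠ 0) (s : Store d) (hn : 0 < s.nat 0 1) {N : ℕ}
    (hN : s.nat B 0 < N) (hk : 1 ≤ s.nat 2 0)
    (hMk : s.nat 0 0 * s.nat 2 0 ≤ N) :
    Halts G (decode A B) s (140 * N * N) fun s' => ∀ i < s.nat 0 0,
      s'.vec A i = codedStrategy (s.vec 0) (s.nat 0 1) (s.nat 2 0) (s.nat B 0) i := by
  refine (Halts.setNat_seq (Halts.setNat_seq (Halts.loop (T := 110 * s.nat 2 0 * N) (s.nat 0 0)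
    (fun m s' => s'.nat 7 0 = s.nat B 0 / s.nat 0 1 ^ (m * s.nat 2 0) ∧ s'.nat 8 0 = m ∧
      ∀ i < m, s'.vec A i = codedStrategy (s.vec 0) (s.nat 0 1) (s.nat 2 0) (s.nat B 0) i)
    ?_ ?_ ?_))).mono ?_ fun _ h => h.2.2
  · simp [NatExpr.eval]
  · rintro m s' - ⟨-, h8, -⟩ hF
    have h0 := congrFun (hF.nat 0 (by simp [natWrites_decodeStrategy])) 0
    simp [NatExpr.eval] at h0
    simp [Test.holds, NatExpr.eval, h0, h8]
  · rintro m s' - ⟨h7, h8, hv⟩ hF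
    have h2 := congrFun (hF.nat 2 (by simp [natWrites_decodeStrategy])) 0
    have h0 := congrFun (hF.nat 0 (by simp [natWrites_decodeStrategy])) 1
    have hv0 := hF.vec 0 (by
      simp [vecWrites_decodeStrategy, hA.symm])
    simp [NatExpr.eval] at h2 h0
    refine (halts_decodeStrategy hA s' (h0 ▸ hn) (N := N) ?_ (h2 ▸ hk)).mono (by rw [h2]) ?_
    · rw [h7]
      exact (Nat.div_le_self _ _).trans_lt hN
    · rintro s'' ⟨h7', h8', hv'⟩
      refine ⟨?_, by rw [h8', h8], fun i hi => ?_⟩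
      · rw [h7', h7, h0, h2, Nat.div_div_eq_div_mul, ← pow_add, Nat.succ_mul]
      · rw [hv', h8, h2, h0, h7, hv0]
        rcases Nat.lt_succ_iff_lt_or_eq.1 hi with hi | rfl
        · rw [Function.update_of_ne hi.ne, hv i hi]
        · rw [Function.update_self]
          rfl
  · simp only [NatExpr.cost, Test.cost]
    have hN1 : 1 ≤ N := by lia
    have hMN : s.nat 0 0 ≤ N := by nlinarith
    have h1 := Nat.mul_le_mul_right N hMk
    have h2 : N ≤ N * N := by nlinarith
    nlinarith

/-- The memory holds the size of the game, the parameter `k`, the number `N` of encoded profiles,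
the vectors `Y` and the accuracy `ε`. -/
structure Setup (s : Store d) (M n k N : ℕ) (ε : ℝ) (Y : ℕ → Fin d → ℝ) : Prop where
  players : s.nat 0 0 = M
  vertices : s.nat 0 1 = n
  size : s.nat 2 0 = k
  count : s.nat 3 0 = N
  points : s.vec 0 = Y
  accuracy : s.real 0 3 = ε

variable {s : Store d} {k N : ℕ} {ε : ℝ} {Y : ℕ → Fin d → ℝ}

theorem Setup.congr {s' : Store d} (h : Setup s M n k N ε Y) (h0 : s'.nat 0 = s.nat 0)
    (h2 : s'.nat 2 = s.nat 2) (h3 : s'.nat 3 = s.nat 3) (hr : s'.real 0 = s.real 0)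
    (hv : s'.vec 0 = s.vec 0) : Setup s' M n k N ε Y :=
  ⟨by rw [h0, h.players], by rw [h0, h.vertices], by rw [h2, h.size], by rw [h3, h.count],
    by rw [hv, h.points], by rw [hr, h.accuracy]⟩

theorem Setup.frame {P : Program} {s' : Store d} (h : Setup s M n k N ε Y) (hF : P.Frame s s')
    (h0 : 0 ∉ P.natWrites) (h2 : 2 ∉ P.natWrites) (h3 : 3 ∉ P.natWrites) (hr : 0 ∉ P.realWrites)
    (hv : 0 ∉ P.vecWrites) : Setup s' M n k N ε Y :=
  h.congr (hF.nat 0 h0) (hF.nat 2 h2) (hF.nat 3 h3) (hF.real 0 hr) (hF.vec 0 hv)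

theorem Setup.setNat (h : Setup s M n k N ε Y) {A : ℕ} (a v : ℕ) (h0 : 0 ≠ A) (h2 : 2 ≠ A)
    (h3 : 3 ≠ A) : Setup (s.setNat A a v) M n k N ε Y :=
  h.congr (Function.update_of_ne h0 _ _) (Function.update_of_ne h2 _ _)
    (Function.update_of_ne h3 _ _) rfl rfl

theorem Store.profile_eq (s : Store d) (M A : ℕ) : s.profile M A = fun j : Fin M => s.vec A j := rfl

@[simp]
theorem Store.profile_setNat (s : Store d) (M A a v B : ℕ) :
    (s.setNat A a v).profile M B = s.profile M B := rfl

/-- The profile that is encoded by `e`. -/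
noncomputable def codedProfile (Y : ℕ → Fin d → ℝ) (M n k e : ℕ) : Profile M d :=
  fun i => codedStrategy Y n k e i

theorem Setup.halts_decode {A B : ℕ} (h : Setup s M n k N ε Y) (hA : A ≠ 0) (hn : 0 < n)
    (hk : 1 ≤ k) (hMk : M * k ≤ N) {e : ℕ} (he : s.nat B 0 = e) (heN : e < N) :
    Halts G (decode A B) s (140 * N * N) fun s' => s'.profile M A = codedProfile Y M n k e := by
  have := LipGame.halts_decode (G := G) (B := B) hA s (h.vertices ▸ hn) (N := N) (he ▸ heN)
    (h.size ▸ hk) (by rw [h.players, h.size]; exact hMk)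
  rw [h.players, h.vertices, h.size, h.points, he] at this
  exact this.mono le_rfl fun s' hs' => funext fun i => hs' i i.2

/-- The deviation is made in place: the old strategy is saved in array 3 and restored after the
test, so array 4 ends as it began. -/
theorem halts_testDeviation {x z : Profile M d} {i : Fin M} (hx : s.profile M 4 = x)
    (hz : s.profile M 2 = z) (hi : s.nat 11 0 = i) (hε : s.real 0 3 = ε) :
    Halts G testDeviation s 60 fun s' => s'.profile M 4 = x ∧ s'.nat 11 0 = i + 1 ∧
      (0 < s'.nat 6 0 ↔ 0 < s.nat 6 0 ∧
        G.utility i (Function.update x i (z i)) - 2 * ε ≤ G.utility i x) := by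
  refine (Halts.setReal_seq (Halts.setVec_seq (Halts.setVec_seq (Halts.seq (T' := 20) (
    Halts.branch (T := 3)
      (Q := fun s' => s'.profile M 4 = Function.update x i (z i) ∧ s'.vec 3 0 = x i ∧
        s'.nat 11 0 = i ∧ (0 < s'.nat 6 0 ↔ 0 < s.nat 6 0 ∧
          G.utility i (Function.update x i (z i)) - 2 * ε ≤ G.utility i x)) ?_ ?_)
      ?_)))).mono ?_ fun _ h => h
  all_goals
    try
      have hx' : ∀ j : Fin M, s.vec 4 j = x j := fun j => congrFun hx j
      have hz' : ∀ j : Fin M, s.vec 2 j = z j := fun j => congrFun hz j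
      have hxi := hx' i
      have hxf : (fun j : Fin M => s.vec 4 j) = x := hx
      have hupd : ∀ w : Fin d → ℝ, (fun j : Fin M => if (j : ℕ) = i then w else s.vec 4 j)
          = Function.update x i w := fun w => by
        funext j
        simp only [Function.update_apply, Fin.ext_iff, hx']
  · intro hb
    refine Halts.setNat ?_
    simp [Test.holds, NatExpr.eval, RealExpr.eval, VecExpr.eval, Store.profile_eq, hi, hε, hz', hupd, hxi, hxf] at hb ⊢
    intro _
    linarith
  · intro hb
    refine (Halts.nop ?_).mono (by norm_num) fun _ h => h
    simp [Test.holds, NatExpr.eval, RealExpr.eval, VecExpr.eval, Store.profile_eq, hi, hε, hz', hupd, hxi, hxf] at hb ⊢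
    intro _
    linarith
  · rintro s' ⟨h4, h3, h11, h6⟩ -
    refine (Halts.setVec_seq (Halts.setNat ?_)).mono (by simp [NatExpr.cost, VecExpr.cost])
      fun _ h => h
    refine ⟨?_, by simp [NatExpr.eval, h11], by simpa [NatExpr.eval] using h6⟩
    funext j
    have := congrFun h4 j
    simp only [Store.profile, Function.update_apply, Fin.ext_iff] at this
    simp only [Store.profile, NatExpr.eval, VecExpr.eval, Store.vec_setNat, Store.vec_setVec, h11,
      true_and, h3, this]
    split_ifs with hj
    · rw [Fin.ext hj]
    · rfl
  · simp [NatExpr.cost, VecExpr.cost, RealExpr.cost, Test.cost]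

/-- No player gains more than `2 * ε` by a deviation from `x` to the strategy in `z`. -/
def Game.Resists (G : Game M n d) (ε : ℝ) (x z : Profile M d) : Prop :=
  ∀ i, G.utility i (Function.update x i (z i)) - 2 * ε ≤ G.utility i x

/-- One coded profile supplies a deviation for every player, so running through all codes covers
every grid deviation of every player. -/
theorem halts_testDeviations (h : Setup s M n k N ε Y) (hn : 0 < n) (hk : 1 ≤ k)
    (hMk : M * k ≤ N) {x : Profile M d} (hx : s.profile M 4 = x) {f : ℕ} (hf : s.nat 5 0 = f)
    (hfN : f < N) :
    Halts G testDeviations s (240 * N * N) fun s' => s'.profile M 4 = x ∧ s'.nat 5 0 = f + 1 ∧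
      (0 < s'.nat 6 0 ↔ 0 < s.nat 6 0 ∧ G.Resists ε x (codedProfile Y M n k f)) := by
  refine (Halts.seq (T' := 100 * N) (h.halts_decode two_ne_zero hn hk hMk hf hfN)
    fun s₁ h2 hF => ?_).mono ?_ fun _ h => h
  · have h₁ : Setup s₁ M n k N ε Y := h.frame hF (by decide) (by decide) (by decide) (by decide)
      (by decide)
    have h4 : s₁.profile M 4 = x := by
      rw [← hx, Store.profile_eq, Store.profile_eq]; rw [hF.vec 4 (by decide)]
    have h5 := hF.nat 5 (by decide)
    have h6 := hF.nat 6 (by decide)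
    set z : Profile M d := codedProfile Y M n k f with hz
    refine (Halts.setNat_seq (Halts.seq (T' := 7) (Halts.loop (T := 60) M
      (fun m s' => s'.profile M 4 = x ∧ s'.nat 11 0 = m ∧ (0 < s'.nat 6 0 ↔ 0 < s.nat 6 0 ∧
        ∀ i : Fin M, (i : ℕ) < m →
          G.utility i (Function.update x i (z i)) - 2 * ε ≤ G.utility i x))
      ?_ ?_ ?_) ?_)).mono ?_ fun _ h => h
    · refine ⟨h4, by simp [NatExpr.eval], ?_⟩
      simp [NatExpr.eval, h6]
    · rintro m s' - ⟨-, h11, -⟩ hF'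
      have h0 := congrFun (hF'.nat 0 (by decide)) 0
      simp [NatExpr.eval, h₁.players] at h0
      simp [Test.holds, NatExpr.eval, h11, h0]
    · rintro m s' hm ⟨h4', h11, h6'⟩ hF'
      have h2' : s'.profile M 2 = z := by
        rw [← h2]; unfold Store.profile; rw [hF'.vec 2 (by decide)]; rfl
      have hε : s'.real 0 3 = ε := by
        rw [hF'.real 0 (by decide)]; exact h₁.accuracy
      refine (halts_testDeviation (i := ⟨m, hm⟩) h4' h2' h11 hε).mono le_rfl ?_
      rintro s'' ⟨h4'', h11', h6''⟩
      refine ⟨h4'', h11', ?_⟩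
      rw [h6'', h6', and_assoc]
      refine and_congr_right fun _ => ⟨fun H i hi => ?_, fun H => ⟨fun i hi => H i (by lia), ?_⟩⟩
      · rcases Nat.lt_succ_iff_lt_or_eq.1 hi with hi | hi
        · exact H.1 i hi
        · obtain rfl : i = ⟨m, hm⟩ := Fin.ext hi
          exact H.2
      · exact H ⟨m, hm⟩ (by simp)
    · rintro s' ⟨h4', -, h6'⟩ hF'
      have h5' := congrFun (hF'.nat 5 (by decide)) 0
      simp [NatExpr.eval, h5, hf] at h5'
      refine (Halts.setNat ?_).mono (by simp [NatExpr.cost]) fun _ h => h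
      refine ⟨h4', by simp [NatExpr.eval, h5'], ?_⟩
      simp only [Store.nat_setNat]
      simp [h6', Game.Resists]
    · simp only [NatExpr.cost, Test.cost]
      have : M ≤ N := le_trans (Nat.le_mul_of_pos_right M hk) hMk
      lia
  · nlinarith

theorem halts_examine (h : Setup s M n k N ε Y) (hn : 0 < n) (hk : 1 ≤ k) (hMk : M * k ≤ N)
    {e : ℕ} (he : s.nat 4 0 = e) (heN : e < N) :
    Halts G examine s (600 * N * N * N) fun s' => s'.nat 4 0 = e + 1 ∧
      (((∀ f < N, G.Resists ε (codedProfile Y M n k e) (codedProfile Y M n k f)) ∧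
        s'.nat 1 0 = 1 ∧ s'.profile M 1 = codedProfile Y M n k e) ∨
      ((¬ ∀ f < N, G.Resists ε (codedProfile Y M n k e) (codedProfile Y M n k f)) ∧
        s'.nat 1 0 = s.nat 1 0 ∧ s'.profile M 1 = s.profile M 1)) := by
  have hN1 : 1 ≤ N := by lia
  have hNN : N ≤ N * N := by nlinarith
  have hNNN : N * N ≤ N * N * N := by nlinarith
  refine (Halts.seq (T' := 450 * N * N * N) (h.halts_decode four_ne_zero hn hk hMk he heN)
    fun s₁ h4 hF => ?_).mono (by nlinarith) fun _ h => h
  have h₁ : Setup s₁ M n k N ε Y := h.frame hF (by decide) (by decide) (by decide) (by decide)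
    (by decide)
  set x : Profile M d := codedProfile Y M n k e with hx
  refine (Halts.setNat_seq (Halts.setNat_seq (Halts.seq (T' := 160 * N * N)
    (Halts.loop (T := 240 * N * N) N
    (fun m s' => s'.profile M 4 = x ∧ s'.nat 5 0 = m ∧ (0 < s'.nat 6 0 ↔
      ∀ f < m, G.Resists ε x (codedProfile Y M n k f))) ?_ ?_ ?_) ?_))).mono ?_ fun _ h => h
  · refine ⟨h4, by simp [NatExpr.eval], ?_⟩
    simp [NatExpr.eval]
  · rintro m s' - ⟨-, h5, -⟩ hF'
    have h3 := congrFun (hF'.nat 3 (by decide)) 0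
    simp [NatExpr.eval, h₁.count] at h3
    simp [Test.holds, NatExpr.eval, h5, h3]
  · rintro m s' hm ⟨h4', h5, h6⟩ hF'
    have h' : Setup s' M n k N ε Y := by
      refine Setup.frame ((h₁.setNat _ _ ?_ ?_ ?_).setNat _ _ ?_ ?_ ?_) hF' ?_ ?_ ?_ ?_ ?_
      all_goals decide
    refine (halts_testDeviations h' hn hk hMk h4' h5 hm).mono le_rfl ?_
    rintro s'' ⟨h4'', h5', h6'⟩
    refine ⟨h4'', h5', ?_⟩
    rw [h6', h6]
    refine ⟨fun H f hf => ?_, fun H => ⟨fun f hf => H f (by lia), H m (by lia)⟩⟩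
    rcases Nat.lt_succ_iff_lt_or_eq.1 hf with hf | rfl
    · exact H.1 f hf
    · exact H.2
  · rintro s' ⟨h4', h5, h6⟩ hF'
    have h' : Setup s' M n k N ε Y := by
      refine Setup.frame ((h₁.setNat _ _ ?_ ?_ ?_).setNat _ _ ?_ ?_ ?_) hF' ?_ ?_ ?_ ?_ ?_
      all_goals decide
    have he' : s'.nat 4 0 = e := by
      have := congrFun (hF'.nat 4 (by decide)) 0
      simp [NatExpr.eval] at this
      rw [this, hF.nat 4 (by decide), he]
    have h1 : s'.nat 1 0 = s.nat 1 0 := by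
      have := congrFun (hF'.nat 1 (by decide)) 0
      simp [NatExpr.eval] at this
      rw [this, hF.nat 1 (by decide)]
    have hv1 : s'.vec 1 = s.vec 1 := by
      rw [hF'.vec 1 (by decide)]
      exact hF.vec 1 (by decide)
    refine (Halts.seq (T' := 7) (Halts.branch (T := 140 * N * N + 4) (Q := fun s'' =>
      s''.nat 4 0 = e ∧
      (((∀ f < N, G.Resists ε x (codedProfile Y M n k f)) ∧
        s''.nat 1 0 = 1 ∧ s''.profile M 1 = x) ∨
      ((¬ ∀ f < N, G.Resists ε x (codedProfile Y M n k f)) ∧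
        s''.nat 1 0 = s.nat 1 0 ∧ s''.profile M 1 = s.profile M 1))) ?_ ?_) ?_).mono ?_ fun _ h => h
    · intro hb
      have hb' : 0 < s'.nat 6 0 := by simpa [Test.holds, NatExpr.eval] using hb
      refine (Halts.seq (T' := 3) (h'.halts_decode one_ne_zero hn hk hMk he' heN)
        fun s₂ h2 hF₂ => ?_).mono (by lia) fun _ h => h
      refine Halts.setNat ⟨?_, Or.inl ⟨h6.1 hb', by simp [NatExpr.eval], h2⟩⟩
      simp [NatExpr.eval, hF₂.nat 4 (by decide), he']
    · intro hb
      have hb' : ¬ 0 < s'.nat 6 0 := by simpa [Test.holds, NatExpr.eval] using hb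
      refine (Halts.nop ⟨he', Or.inr ⟨fun H => hb' (h6.2 H), h1, ?_⟩⟩).mono (by lia) fun _ h => h
      unfold Store.profile
      rw [hv1]
    · rintro s'' ⟨h4'', H⟩ -
      refine (Halts.setNat ?_).mono (by simp [NatExpr.cost]) fun _ h => h
      exact ⟨by simp [NatExpr.eval, h4''], by simpa [NatExpr.eval] using H⟩
    · simp only [NatExpr.cost, Test.cost]
      nlinarith
  · simp only [NatExpr.cost, Test.cost]
    nlinarith

/-- The search does not stop at a success: later successes overwrite the output, failures leave it
alone. The verdict cell starts at 0, which already means that nothing was found. -/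
theorem halts_search (h : Setup s M n k N ε Y) (hn : 0 < n) (hk : 1 ≤ k) (hMk : M * k ≤ N)
    (hN1 : 1 ≤ N) (h1 : s.nat 1 0 = 0) :
    Halts G search s (620 * N ^ 4) fun s' =>
      (Found s' ∧ ∃ e < N, outputProfile s' M = codedProfile Y M n k e ∧
        ∀ f < N, G.Resists ε (codedProfile Y M n k e) (codedProfile Y M n k f)) ∨
      (ReportsNone s' ∧
        ∀ e < N, ¬ ∀ f < N, G.Resists ε (codedProfile Y M n k e) (codedProfile Y M n k f)) := by
  refine (Halts.setNat_seq (Halts.loop (T := 600 * N * N * N) N (fun m s' => s'.nat 4 0 = m ∧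
    ((Found s' ∧ ∃ e < N, outputProfile s' M = codedProfile Y M n k e ∧
        ∀ f < N, G.Resists ε (codedProfile Y M n k e) (codedProfile Y M n k f)) ∨
      (ReportsNone s' ∧
        ∀ e < m, ¬ ∀ f < N, G.Resists ε (codedProfile Y M n k e) (codedProfile Y M n k f))))
    ?_ ?_ ?_)).mono ?_ fun _ h => h.2
  · refine ⟨by simp [NatExpr.eval], Or.inr ⟨by simp [ReportsNone, NatExpr.eval, h1], by simp⟩⟩
  · rintro m s' - ⟨h4, -⟩ hF
    have h3 := congrFun (hF.nat 3 (by decide)) 0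
    simp [NatExpr.eval, h.count] at h3
    simp [Test.holds, NatExpr.eval, h4, h3]
  · rintro m s' hm ⟨h4, H⟩ hF
    have h' : Setup s' M n k N ε Y := by
      refine Setup.frame (h.setNat _ _ ?_ ?_ ?_) hF ?_ ?_ ?_ ?_ ?_
      all_goals decide
    refine (halts_examine h' hn hk hMk h4 hm).mono le_rfl ?_
    rintro s'' ⟨h4', ⟨hR, h1', hp⟩ | ⟨hR, h1', hp⟩⟩
    · exact ⟨h4', Or.inl ⟨h1', m, hm, hp, hR⟩⟩
    · refine ⟨h4', ?_⟩
      unfold Found ReportsNone outputProfile at *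
      rw [h1', hp]
      refine H.imp id fun H => ⟨H.1, fun e he => ?_⟩
      rcases Nat.lt_succ_iff_lt_or_eq.1 he with he | rfl
      · exact H.2 e he
      · exact hR
  · simp only [NatExpr.cost, Test.cost]
    have : N ≤ N ^ 4 := Nat.le_self_pow (by norm_num) N
    have : N * (600 * N * N * N) = 600 * N ^ 4 := by ring
    lia

end Algorithm

/-! ## Correctness of the search -/

section Correctness

open Finset

variable {M n d : ℕ} {G : Game M n d} {lam p γ ε : ℝ} {k : ℕ}

/-- Choices of k vertices by each of M players are functions from Mk positions to n digits; position
ik + j holds the j-th choice of player i. -/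
theorem exists_digits (s : Fin M → ℕ → Fin n) :
    ∃ e < n ^ (M * k), ∀ i : Fin M, ∀ j < k, e / n ^ ((i : ℕ) * k) / n ^ j % n = s i j := by
  let f : Fin (M * k) → Fin n := fun t => s (finProdFinEquiv.symm t).1 (finProdFinEquiv.symm t).2
  refine ⟨finFunctionFinEquiv f, (finFunctionFinEquiv f).2, fun i j hj => ?_⟩
  have h := congrArg Fin.val (congrFun (finFunctionFinEquiv.symm_apply_apply f)
    (finProdFinEquiv (i, ⟨j, hj⟩)))
  have hij : (finProdFinEquiv (i, (⟨j, hj⟩ : Fin k)) : ℕ) = i * k + j := by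
    simp [finProdFinEquiv, mul_comm, add_comm]
  rw [finFunctionFinEquiv_symm_apply_val, hij] at h
  rw [Nat.div_div_eq_div_mul, ← pow_add]
  refine h.trans ?_
  simp only [f, Equiv.symm_apply_apply]

theorem input_vec (i : Fin M) (j : Fin n) :
    (input G lam p γ ε).vec 0 (n * i + j) = G.vertex i j := by
  have h : n * (i : ℕ) + j = finProdFinEquiv (i, j) := by simp [finProdFinEquiv, add_comm]
  have hlt : n * (i : ℕ) + j < M * n := h ▸ (finProdFinEquiv (i, j)).2
  simp only [input, hlt, and_self, dite_true]
  have : (⟨n * i + j, hlt⟩ : Fin (M * n)) = finProdFinEquiv (i, j) := Fin.ext h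
  rw [this, Equiv.symm_apply_apply]

/-- Digits are reduced modulo n, so every number decodes to averages of genuine vertices, whether or
not it is below n^(Mk). -/
theorem codedProfile_mem (hn : 1 ≤ n) (hk : 1 ≤ k) (e : ℕ) :
    codedProfile ((input G lam p γ ε).vec 0) M n k e ∈ G.profiles := by
  intro i
  unfold codedProfile codedStrategy digitAverage
  refine (convex_convexHull ℝ _).sum_mem (fun _ _ => by positivity) ?_ fun j _ => ?_
  · have : (k : ℝ) ≠ 0 := by positivity
    simp [this]
  · have := input_vec (G := G) (lam := lam) (p := p) (γ := γ) (ε := ε) i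
      ⟨e / n ^ ((i : ℕ) * k) / n ^ j % n, Nat.mod_lt _ hn⟩
    rw [this]
    exact subset_convexHull ℝ _ ⟨_, rfl⟩

theorem exists_codedProfile_near (hG : G.IsLipschitz lam p γ) (hp : 2 ≤ p) (hγ : 0 < γ)
    (hk : 1 ≤ k) {x : Profile M d} (hx : x ∈ G.profiles) :
    ∃ e < n ^ (M * k), ∀ i,
      pNorm p (x i - codedProfile ((input G lam p γ ε).vec 0) M n k e i) ≤
        2 * γ * √(7 * p / k) := by
  choose s hs using fun i => exists_average_pNorm_sub_le hp hγ (hG i).1 (hx i) hk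
  obtain ⟨e, he, hes⟩ := exists_digits (k := k) s
  refine ⟨e, he, fun i => ?_⟩
  have : codedProfile ((input G lam p γ ε).vec 0) M n k e i
      = ∑ j ∈ range k, (1 / (k : ℝ)) • G.vertex i (s i j) := by
    unfold codedProfile codedStrategy digitAverage
    refine sum_congr rfl fun j hj => ?_
    rw [hes i j (mem_range.1 hj), input_vec]
  rw [this]
  exact hs i

theorem utility_sub_le (hG : G.IsLipschitz lam p γ) (hp : 2 ≤ p) (hM : 1 ≤ M) {η : ℝ}
    (hη : 0 ≤ η) {x y : Profile M d} (hx : x ∈ G.profiles) (hy : y ∈ G.profiles)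
    (h : ∀ i, pNorm p (x i - y i) ≤ η) (i : Fin M) :
    |G.utility i x - G.utility i y| ≤ |lam| * (√M * η) := by
  refine ((hG i).2 x hx y hy).trans ?_
  refine (mul_le_mul_of_nonneg_right (le_abs_self lam) (pNorm_nonneg _ _)).trans ?_
  exact mul_le_mul_of_nonneg_left (pNorm_profile_le hp hM hη h) (abs_nonneg _)

theorem update_mem_profiles {x : Profile M d} (hx : x ∈ G.profiles) {i : Fin M} {z : Fin d → ℝ}
    (hz : z ∈ G.strategySpace i) : Function.update x i z ∈ G.profiles := by
  intro j
  rcases eq_or_ne j i with rfl | hj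
  · rwa [Function.update_self]
  · rw [Function.update_of_ne hj]
    exact hx j

theorem pNorm_update_sub_update_le {η : ℝ} {x y : Profile M d}
    (i : Fin M) {z w : Fin d → ℝ} (h : ∀ j, j ≠ i → pNorm p (x j - y j) ≤ η)
    (hzw : pNorm p (z - w) ≤ η) (j : Fin M) :
    pNorm p (Function.update x i z j - Function.update y i w j) ≤ η := by
  rcases eq_or_ne j i with rfl | hj
  · simpa using hzw
  · simpa [Function.update_of_ne hj] using h j hj

theorem pNorm_sub_self_le {ι : Type} [Fintype ι] {η : ℝ} (hp : 0 < p) (hη : 0 ≤ η) (x : ι → ℝ) :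
    pNorm p (x - x) ≤ η := by
  refine pNorm_le_of_sum_le hp hη ?_
  simp only [sub_self, Pi.zero_apply, abs_zero, Real.zero_rpow hp.ne', sum_const_zero]
  positivity

theorem mul_sqrt_le (hp : 2 ≤ p) (hε : 0 < ε) (hk : 1 ≤ k)
    (hX : 28 * (lam ^ 2 * M * p * γ ^ 2 / ε ^ 2) ≤ k) :
    |lam| * (√M * (2 * γ * √(7 * p / k))) ≤ ε := by
  have hk0 : (0 : ℝ) < k := by exact_mod_cast hk
  -- Squaring the left side gives 4 · 7 = 28 times lam² M p γ² / k, the source of the 28 in the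
  -- choice of k.
  refine abs_le_of_sq_le_sq' ?_ hε.le |>.2
  rw [mul_pow, mul_pow, mul_pow, sq_abs, Real.sq_sqrt (by positivity),
    Real.sq_sqrt (by positivity)]
  rw [← mul_div_assoc, div_le_iff₀ (by positivity)] at hX
  field_simp
  linarith

/-- With y near an equilibrium x: u(y with z) ≤ u(x with z) + ε ≤ u(x) + ε ≤ u(y) + 2ε. -/
theorem resists_of_isEquilibrium (hG : G.IsLipschitz lam p γ) (hp : 2 ≤ p) (hM : 1 ≤ M)
    {η : ℝ} (hη : 0 ≤ η) (hε : |lam| * (√M * η) ≤ ε) {x y : Profile M d} (hx : G.IsEquilibrium x)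
    (hy : y ∈ G.profiles) (hxy : ∀ i, pNorm p (x i - y i) ≤ η) {z : Profile M d}
    (hz : z ∈ G.profiles) : G.Resists ε y z := by
  intro i
  have h1 := utility_sub_le hG hp hM hη hx.1 hy hxy i
  have h2 := utility_sub_le hG hp hM hη (update_mem_profiles hx.1 (hz i))
    (update_mem_profiles hy (hz i)) (pNorm_update_sub_update_le i
      (fun j _ => hxy j) (pNorm_sub_self_le (by linarith) hη _)) i
  have h3 := hx.2 i (z i) (hz i)
  rw [abs_le] at h1 h2
  linarith [h1.2, h2.1]

theorem isApproxEquilibrium_of_resists (hG : G.IsLipschitz lam p γ) (hp : 2 ≤ p) (hM : 1 ≤ M)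
    {η : ℝ} (hη : 0 ≤ η) (hε : |lam| * (√M * η) ≤ ε) {x : Profile M d} (hx : x ∈ G.profiles)
    {S : Set (Profile M d)} (hS : S ⊆ G.profiles)
    (hd : ∀ y ∈ G.profiles, ∃ z ∈ S, ∀ i, pNorm p (y i - z i) ≤ η)
    (hR : ∀ z ∈ S, G.Resists ε x z) : G.IsApproxEquilibrium (3 * ε) x := by
  refine ⟨hx, fun i w hw => ?_⟩
  -- The whole deviated profile is rounded, but only the i-th component of z is used: the other
  -- players keep playing x.
  obtain ⟨z, hz, hwz⟩ := hd _ (update_mem_profiles hx hw)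
  have hwz' := hwz i
  rw [Function.update_self] at hwz'
  have h1 := utility_sub_le hG hp hM hη (update_mem_profiles hx hw)
    (update_mem_profiles hx (hS hz i)) (pNorm_update_sub_update_le i
      (fun j _ => pNorm_sub_self_le (by linarith) hη _) hwz') i
  have h2 := hR z hz i
  rw [abs_le] at h1
  linarith [h1.2]

/-- Any two profiles differ by at most 2γ per player. The squared utility change is thus at most 4
lam² M γ² ≤ 2 lam² M p γ² < 2ε². -/
theorem isApproxEquilibrium_of_ratio_lt_one (hG : G.IsLipschitz lam p γ) (hp : 2 ≤ p) (hM : 1 ≤ M)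
    (hε : 0 < ε) (hX : lam ^ 2 * M * p * γ ^ 2 / ε ^ 2 < 1) {x : Profile M d}
    (hx : x ∈ G.profiles) : G.IsApproxEquilibrium (3 * ε) x := by
  refine ⟨hx, fun i z hz => ?_⟩
  have hγ : 0 ≤ γ := (pNorm_nonneg p z).trans ((hG i).1 z hz)
  have h1 := utility_sub_le hG hp hM (by positivity : 0 ≤ 2 * γ) (update_mem_profiles hx hz) hx
    (fun j => by
      have := pNorm_sub_le (by linarith : 1 ≤ p) (Function.update x i z j) (x j)
      linarith [(hG j).1 _ (hx j), (hG j).1 _ (update_mem_profiles hx hz j)]) i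
  have h2 : |lam| * (√M * (2 * γ)) ≤ 3 * ε := by
    refine abs_le_of_sq_le_sq' ?_ (by positivity) |>.2
    rw [mul_pow, mul_pow, mul_pow, sq_abs, Real.sq_sqrt (by positivity)]
    rw [div_lt_one (by positivity)] at hX
    have : 0 ≤ lam ^ 2 * M * γ ^ 2 * (p - 2) := mul_nonneg (by positivity) (by linarith)
    nlinarith
  have := (le_abs_self _).trans (h1.trans h2)
  linarith

theorem isApproxEquilibrium_of_vertices_eq (hn : n = 1) (hε : 0 < ε) {x : Profile M d}
    (hx : x ∈ G.profiles) : G.IsApproxEquilibrium (3 * ε) x := by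
  subst hn
  refine ⟨hx, fun i z hz => ?_⟩
  have h : ∀ w ∈ G.strategySpace i, w = G.vertex i 0 := fun w hw => by
    rw [Game.strategySpace, Set.range_unique, convexHull_singleton] at hw
    exact hw
  have : Function.update x i z = x := by
    rw [h z hz, ← h (x i) (hx i), Function.update_eq_self]
  rw [this]
  linarith

end Correctness

/-! ## The running time of the program -/

section Time

variable {M n d : ℕ} {G : Game M n d} {s : Store d} {lam p γ ε : ℝ} {k : ℕ}

theorem eval_ratioExpr (h0 : s.nat 0 0 = M) (hr : s.real 0 = (input G lam p γ ε).real 0) :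
    ratioExpr.eval G s = lam ^ 2 * M * p * γ ^ 2 / ε ^ 2 := by
  simp [ratioExpr, RealExpr.eval, NatExpr.eval, h0, hr, input]
  ring_nf

/-- Without a rounding operation the ceiling is found by counting up to the first natural number not
below the real value. -/
theorem halts_computeSize (h0 : s.nat 0 0 = M) (hr : s.real 0 = (input G lam p γ ε).real 0) :
    Halts G computeSize s (60 * (⌈28 * (lam ^ 2 * M * p * γ ^ 2 / ε ^ 2)⌉₊ + 1)) fun s' =>
      s'.nat 2 0 = ⌈28 * (lam ^ 2 * M * p * γ ^ 2 / ε ^ 2)⌉₊ := by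
  refine (Halts.setNat_seq (Halts.loop (T := 7) _ (fun m s' => s'.nat 2 0 = m)
    (by simp [NatExpr.eval]) ?_ ?_)).mono ?_ fun _ h => h
  · intro m s' _ hI hF
    have h0' := congrFun (hF.nat 0 (by decide)) 0
    have hr' := hF.real 0 (by decide)
    simp only [Store.nat_setNat, Store.real_setNat, h0, hr] at h0' hr'
    rw [Nat.lt_ceil, ← eval_ratioExpr (h0'.trans (by simp)) hr']
    simp [Test.holds, RealExpr.eval, NatExpr.eval, hI]
  · intro m s' _ hI _
    exact (Halts.setNat (by simp [NatExpr.eval, hI])).mono (by simp [NatExpr.cost]) fun _ h => h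
  · simp only [NatExpr.cost, Test.cost, RealExpr.cost, ratioExpr]
    lia

theorem halts_computeCount (s : Store d) :
    Halts G computeCount s (60 * (s.nat 0 0 * s.nat 2 0 + 1)) fun s' =>
      s'.nat 3 0 = s.nat 0 1 ^ (s.nat 0 0 * s.nat 2 0) := by
  refine (Halts.setNat_seq (Halts.setNat_seq (Halts.loop (T := 20) (s.nat 0 0 * s.nat 2 0)
    (fun m s' => s'.nat 3 0 = s.nat 0 1 ^ m ∧ s'.nat 12 0 = m)
    (by simp [NatExpr.eval]) ?_ ?_))).mono ?_ fun _ h => h.1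
  · rintro m s' - ⟨-, h12⟩ hF
    have h0 := congrFun (hF.nat 0 (by decide)) 0
    have h2 := congrFun (hF.nat 2 (by decide)) 0
    simp [NatExpr.eval] at h0 h2
    simp [Test.holds, NatExpr.eval, h0, h2, h12]
  · rintro m s' - ⟨h3, h12⟩ hF
    have h0 := congrFun (hF.nat 0 (by decide)) 1
    simp [NatExpr.eval] at h0
    refine (Halts.setNat_seq (Halts.setNat ?_)).mono (by simp [NatExpr.cost]) fun _ h => h
    simp [NatExpr.eval, h3, h12, h0, pow_succ]
  · simp only [NatExpr.cost, Test.cost]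
    lia

theorem halts_outputFirst (s : Store d) :
    Halts G outputFirst s (60 * (s.nat 0 0 + 1)) fun s' => Found s' ∧
      ∀ i < s.nat 0 0, s'.vec 1 i = s.vec 0 (s.nat 0 1 * i) := by
  refine (Halts.setNat_seq (Halts.seq (T' := 3) (Halts.loop (T := 20) (s.nat 0 0)
    (fun m s' => s'.nat 12 0 = m ∧ ∀ i < m, s'.vec 1 i = s.vec 0 (s.nat 0 1 * i))
    (by simp [NatExpr.eval]) ?_ ?_) ?_)).mono ?_ fun _ h => h
  · rintro m s' - ⟨h12, -⟩ hF
    have h0 := congrFun (hF.nat 0 (by decide)) 0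
    simp [NatExpr.eval] at h0
    simp [Test.holds, NatExpr.eval, h0, h12]
  · rintro m s' - ⟨h12, hv⟩ hF
    have h0 := congrFun (hF.nat 0 (by decide)) 1
    have hv0 := hF.vec 0 (by decide)
    simp [NatExpr.eval] at h0 hv0
    refine (Halts.setVec_seq (Halts.setNat ?_)).mono (by simp [NatExpr.cost, VecExpr.cost])
      fun _ h => h
    refine ⟨by simp [NatExpr.eval, h12], fun i hi => ?_⟩
    rcases Nat.lt_succ_iff_lt_or_eq.1 hi with hi | rfl
    · simp [NatExpr.eval, h12, hi.ne, hv i hi]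
    · simp [NatExpr.eval, VecExpr.eval, h12, h0, hv0]
  · rintro s' ⟨-, hv⟩ -
    exact Halts.setNat ⟨by simp [Found, NatExpr.eval], by simpa using hv⟩
  · simp only [NatExpr.cost, Test.cost]
    lia

theorem halts_equilibriumProgram_of_small (G : Game M n d) (lam p γ ε : ℝ) (hM : 1 ≤ M)
    (h : n ≤ 1 ∨ lam ^ 2 * M * p * γ ^ 2 / ε ^ 2 < 1) :
    Halts G equilibriumProgram (input G lam p γ ε) (200 * M) fun s' => Found s' ∧
      ∀ i < M, s'.vec 1 i = (input G lam p γ ε).vec 0 (n * i) := by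
  have h0 : (input G lam p γ ε).nat 0 0 = M := by simp [input]
  have h1 : (input G lam p γ ε).nat 0 1 = n := by simp [input]
  refine (Halts.branch (T := 60 * (M + 1)) (fun hb => ?_) fun _ => ?_).mono ?_ fun _ h => h
  · simp only [Test.holds, NatExpr.eval, h1, eval_ratioExpr h0 rfl, RealExpr.eval,
      Nat.cast_one] at hb
    rcases h with h | h
    · exact absurd hb.1 (by lia)
    · exact absurd h hb.2
  · have := halts_outputFirst (G := G) (input G lam p γ ε)
    rwa [h0, h1] at this
  · simp only [Test.cost, NatExpr.cost, RealExpr.cost, ratioExpr]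
    lia

theorem halts_equilibriumProgram_of_large (G : Game M n d) (lam p γ ε : ℝ) (hM : 1 ≤ M)
    (hn : 1 < n) (hX : 1 ≤ lam ^ 2 * M * p * γ ^ 2 / ε ^ 2)
    (hk : k = ⌈28 * (lam ^ 2 * M * p * γ ^ 2 / ε ^ 2)⌉₊) :
    Halts G equilibriumProgram (input G lam p γ ε) (1000 * n ^ (M * (4 * k))) fun s' =>
      (Found s' ∧ ∃ e < n ^ (M * k),
        outputProfile s' M = codedProfile ((input G lam p γ ε).vec 0) M n k e ∧
        ∀ f < n ^ (M * k), G.Resists ε (codedProfile ((input G lam p γ ε).vec 0) M n k e)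
          (codedProfile ((input G lam p γ ε).vec 0) M n k f)) ∨
      (ReportsNone s' ∧ ∀ e < n ^ (M * k), ¬ ∀ f < n ^ (M * k),
        G.Resists ε (codedProfile ((input G lam p γ ε).vec 0) M n k e)
          (codedProfile ((input G lam p γ ε).vec 0) M n k f)) := by
  have h0 : (input G lam p γ ε).nat 0 0 = M := by simp [input]
  have h1 : (input G lam p γ ε).nat 0 1 = n := by simp [input]
  have hk1 : 1 ≤ k := by
    rw [hk, Nat.one_le_ceil_iff]
    linarith
  -- Here n ≥ 2 is essential: it makes the linear preprocessing costs and the factors k and M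
  -- negligible against N.
  have hMk : M * k < n ^ (M * k) := Nat.lt_pow_self hn
  set N := n ^ (M * k) with hN
  have hkN : k ≤ M * k := Nat.le_mul_of_pos_left k hM
  have hN4 : n ^ (M * (4 * k)) = N ^ 4 := by rw [hN, ← pow_mul]; ring_nf
  refine (Halts.branch (T := 60 * (k + 1) + (60 * (M * k + 1) + 620 * N ^ 4)) (fun _ => ?_)
    fun hb => ?_).mono ?_ fun _ h => h
  · have hsize := halts_computeSize (G := G) h0 rfl
    rw [← hk] at hsize
    refine Halts.seq hsize fun s' h2 hF => ?_
    have h0' : s'.nat 0 0 = M := by rw [hF.nat 0 (by decide), h0]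
    have h1' : s'.nat 0 1 = n := by rw [hF.nat 0 (by decide), h1]
    have hcount := halts_computeCount (G := G) s'
    rw [h0', h1', h2] at hcount
    refine Halts.seq hcount fun s'' h3 hF' => ?_
    have hS : Setup s'' M n k N ε ((input G lam p γ ε).vec 0) := by
      refine ⟨?_, ?_, ?_, h3, ?_, ?_⟩
      · rw [hF'.nat 0 (by decide), h0']
      · rw [hF'.nat 0 (by decide), h1']
      · rw [hF'.nat 2 (by decide), h2]
      · rw [hF'.vec 0 (by decide), hF.vec 0 (by decide)]
      · rw [hF'.real 0 (by decide), hF.real 0 (by decide)]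
        simp [input]
    refine halts_search hS (by lia) hk1 hMk.le (by lia) ?_
    rw [hF'.nat 1 (by decide), hF.nat 1 (by decide)]
    simp [input]
  · refine absurd ?_ hb
    simp only [Test.holds, NatExpr.eval, h1, eval_ratioExpr h0 rfl, RealExpr.eval, Nat.cast_one]
    exact ⟨hn, not_lt.2 hX⟩
  · rw [hN4]
    have : N ≤ N ^ 4 := Nat.le_self_pow (by norm_num) N
    simp only [Test.cost, NatExpr.cost, RealExpr.cost, ratioExpr]
    lia

end Time
end LipGame

/-! ### The theorem: constants and case distinction -/

theorem mainTheorem2 :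
    ∃ (P : Program) (C : ℕ) (c : ℝ),
      ∀ (M n d : ℕ) (_ : 1 ≤ M) (_ : 1 ≤ n)
        (lam p γ ε : ℝ) (_ : 2 ≤ p) (_ : 0 < ε),
      ∃ k l : ℕ,
        (k : ℝ) ≤ c * (lam ^ 2 * M * p * γ ^ 2 / ε ^ 2) ∧
        (l : ℝ) ≤ c * (lam ^ 2 * p * γ ^ 2 / ε ^ 2) ∧
        ∀ G : Game M n d, G.IsLipschitz lam p γ →
          ∃ (t : ℕ) (s : Store d),
            Runs G P (input G lam p γ ε) t s ∧
            t ≤ C * (M * n ^ (M * k + l)) ∧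
            ((Found s ∧ G.IsApproxEquilibrium (3 * ε) (outputProfile s M)) ∨
              (ReportsNone s ∧ ¬ ∃ x, G.IsEquilibrium x)) ∧
            ((∃ x, G.IsEquilibrium x) →
              Found s ∧ G.IsApproxEquilibrium (3 * ε) (outputProfile s M)) := by
  -- Once the ratio is at least 1, the ceiling of 28 times it is at most 29 times it, and the fourth
  -- power of N gives 4 · 29 = 116.
  refine ⟨equilibriumProgram, 1000, 116, fun M n d hM hn lam p γ ε hp hε => ?_⟩
  have hX0 : 0 ≤ lam ^ 2 * M * p * γ ^ 2 / ε ^ 2 := by positivity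
  have hl : ((0 : ℕ) : ℝ) ≤ 116 * (lam ^ 2 * p * γ ^ 2 / ε ^ 2) := by
    rw [Nat.cast_zero]
    positivity
  by_cases h : n ≤ 1 ∨ lam ^ 2 * M * p * γ ^ 2 / ε ^ 2 < 1
  -- When the ratio is tiny the bounds force both exponents to be 0, leaving only time O(M); writing
  -- down the first vertices takes no more.
  · refine ⟨0, 0, by rw [Nat.cast_zero]; positivity, hl, fun G hG => ?_⟩
    obtain ⟨t, s, hrun, ht, hF, hv⟩ := halts_equilibriumProgram_of_small G lam p γ ε hM h
    have hmem : outputProfile s M ∈ G.profiles := fun i => by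
      have := input_vec (G := G) (lam := lam) (p := p) (γ := γ) (ε := ε) i ⟨0, hn⟩
      simp only [add_zero] at this
      rw [← hv i i.2] at this
      exact subset_convexHull ℝ _ ⟨_, this.symm⟩
    have heq : G.IsApproxEquilibrium (3 * ε) (outputProfile s M) :=
      h.elim (fun h => isApproxEquilibrium_of_vertices_eq (le_antisymm h hn) hε hmem)
        fun h => isApproxEquilibrium_of_ratio_lt_one hG hp hM hε h hmem
    refine ⟨t, s, hrun, ht.trans ?_, Or.inl ⟨hF, heq⟩, fun _ => ⟨hF, heq⟩⟩
    simp only [mul_zero, add_zero, pow_zero, mul_one]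
    lia
  · rw [not_or, not_le, not_lt] at h
    obtain ⟨hn1, hX⟩ := h
    obtain ⟨k, hk⟩ : ∃ k, k = ⌈28 * (lam ^ 2 * M * p * γ ^ 2 / ε ^ 2)⌉₊ := ⟨_, rfl⟩
    have hk28 : 28 * (lam ^ 2 * M * p * γ ^ 2 / ε ^ 2) ≤ k := hk ▸ Nat.le_ceil _
    have hk1 : 1 ≤ k := by
      rw [hk, Nat.one_le_ceil_iff]
      linarith
    -- The running time is a multiple of N⁴ = n^(M · 4k). Deviations are tested on the same grid as
    -- candidates, so no separate exponent l is needed.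
    refine ⟨4 * k, 0, ?_, hl, fun G hG => ?_⟩
    · have := Nat.ceil_lt_add_one (mul_nonneg (by norm_num : (0 : ℝ) ≤ 28) hX0)
      rw [← hk] at this
      push_cast
      linarith
    -- Nonnegativity comes from a strategy of norm at most γ, and γ = 0 would make the ratio 0.
    have hγ : 0 < γ := by
      have i : Fin M := ⟨0, hM⟩
      have : 0 ≤ γ := (pNorm_nonneg p _).trans
        ((hG i).1 _ (subset_convexHull ℝ _ ⟨⟨0, hn⟩, rfl⟩))
      refine this.lt_of_ne ?_
      rintro rfl
      norm_num at hX
    have hη : 0 ≤ 2 * γ * √(7 * p / k) := by positivity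
    have hsmall := mul_sqrt_le hp hε hk1 hk28
    obtain ⟨t, s, hrun, ht, hout⟩ := halts_equilibriumProgram_of_large G lam p γ ε hM hn1 hX hk
    have hdense := fun x hx => exists_codedProfile_near (ε := ε) hG hp hγ hk1 (x := x) hx
    have hfound : (∃ e < n ^ (M * k),
        outputProfile s M = codedProfile ((input G lam p γ ε).vec 0) M n k e ∧
        ∀ f < n ^ (M * k), G.Resists ε (codedProfile ((input G lam p γ ε).vec 0) M n k e)
          (codedProfile ((input G lam p γ ε).vec 0) M n k f)) →
        G.IsApproxEquilibrium (3 * ε) (outputProfile s M) := by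
      rintro ⟨e, -, he, hR⟩
      rw [he]
      refine isApproxEquilibrium_of_resists hG hp hM hη hsmall (codedProfile_mem hn hk1 e)
        (S := codedProfile ((input G lam p γ ε).vec 0) M n k '' Set.Iio (n ^ (M * k))) ?_ ?_ ?_
      · rintro _ ⟨f, -, rfl⟩
        exact codedProfile_mem hn hk1 f
      · intro y hy
        obtain ⟨f, hf, hd⟩ := hdense y hy
        exact ⟨_, ⟨f, hf, rfl⟩, hd⟩
      · rintro _ ⟨f, hf, rfl⟩
        exact hR f hf
    have hnone : (∀ e < n ^ (M * k), ¬ ∀ f < n ^ (M * k),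
        G.Resists ε (codedProfile ((input G lam p γ ε).vec 0) M n k e)
          (codedProfile ((input G lam p γ ε).vec 0) M n k f)) → ¬ ∃ x, G.IsEquilibrium x := by
      rintro H ⟨x, hx⟩
      obtain ⟨e, he, hd⟩ := hdense x hx.1
      exact H e he fun f _ => resists_of_isEquilibrium hG hp hM hη hsmall hx
        (codedProfile_mem hn hk1 e) hd (codedProfile_mem hn hk1 f)
    refine ⟨t, s, hrun, ht.trans ?_, ?_, fun hex => ?_⟩
    · rw [add_zero]
      exact Nat.mul_le_mul_left _ (Nat.le_mul_of_pos_left _ hM)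
    · exact hout.imp (And.imp_right hfound) (And.imp_right hnone)
    · rcases hout with hout | hout
      · exact ⟨hout.1, hfound hout.2⟩
      · exact absurd hex (hnone hout.2)
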